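/- **Theorem (SRM for nonlinear dynamics).** Let $n\ge 0$ and $N,T,K\ge 1$ be integers. Let $f_*:\mathbb R^n\to\mathbb R^n$ be (Borel) measurable, let $\mathcal D$ be a probability distribution on $\mathbb R^n$, and for $\xi\in\mathbb R^n$ let $x_0(\xi)=\xi$, $x_{t+1}(\xi)=f_*(x_t(\xi))$. Assume that for some $B>0$, for $\mathcal D$-almost every $\xi$, $\|x_t(\xi)\|_2\le B$ for all $t=0,\dots,T$. Let $\ell:\mathbb R^n\to[0,\infty)$ be locally Lipschitz with $\ell(0)=0$, and let $L>0$ be a Lipschitz constant of $\ell$ on $\{x:\|x\|_2\le 2B\}$ with respect to $\|\cdot\|_2$. For measurable $f:\mathbb R^n\to\mathbb R^n$ and initial states $S_0=(\xi_1,\dots,\xi_N)$, with data set $S=(x_{0:T}(\xi_i))_{i=1}^N$, put $$\mathrm{er}_{\mathcal D}[f]=\mathbb E_{\xi\sim\mathcal D}\Big[\frac1T\sum_{t=0}^{T-1}\ell\big(f(x_t(\xi))-x_{t+1}(\xi)\big)\Big],\qquad \widehat{\mathrm{er}}_S[f]=\frac1{NT}\sum_{i=1}^N\sum_{t=0}^{T-1}\ell\big(f(x_t(\xi_i))-x_{t+1}(\xi_i)\big),$$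 and let the clipped predictor be $\bar f(x)=\frac{B}{\|f(x)\|_2}f(x)$ if $\|f(x)\|_2>B$, and $\bar f(x)=f(x)$ otherwise. Let $\mathcal F_1\subseteq\dots\subseteq\mathcal F_K$ be classes of measurable functions $\mathbb R^n\to\mathbb R^n$, $\mathcal F=\bigcup_{k=1}^K\mathcal F_k$, and $k(f)=\min\{k: f\in\mathcal F_k\}$ for $f\in\mathcal F$. Assume the usual measurability of the loss classes: for all $k$, $m$ and all signs $\sigma\in\{-1,1\}^m$, the supremum over $f\in\mathcal F_k$ of $\sum_{i=1}^m\sigma_i\,\frac1T\sum_{t=0}^{T-1}\ell(\bar f(x_t(\xi_i))-x_{t+1}(\xi_i))$ is a $\mathcal D^m$-a.e. measurable function of $(\xi_1,\dots,\xi_m)$. For a class $\mathcal G$ of real functions and a sample $z=(z_1,\dots,z_N)$ let $\hat{\mathcal R}_z(\mathcal G)=\mathbb E_\sigma\big[\sup_{g\in\mathcal G}\frac1N\sum_{i=1}^N\sigma_i g(z_i)\big]$, with $\sigma$ uniform on $\{-1,1\}^N$, be the empirical Rademacher complexity. With $\bar{\mathcal F}_{k,j}=\{j\text{-th component of }\bar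 f: f\in\mathcal F_k\}$ and $S_t=(x_t(\xi_i))_{i=1}^N$, set $$r_k(S)=\frac{2\sqrt2\,L}{T}\sum_{t=0}^{T-1}\sum_{j=1}^n\hat{\mathcal R}_{S_t}(\bar{\mathcal F}_{k,j}),\qquad \epsilon_k(S,\delta)=r_k(S)+6LB\sqrt{\frac{\log(4/\delta)}{2N}}.$$ An SRM predictor for $S$ is any $f_S^{\mathrm{SRM}}$ for which some pair $(k,f_S^{\mathrm{SRM}})$ minimizes $\widehat{\mathrm{er}}_S[\bar f]+r_k(S)$ over all pairs $(k,f)$ with $1\le k\le K$, $f\in\mathcal F_k$. Then, for every $\delta\in(0,1)$: (a) for each $k\in\{1,\dots,K\}$, with probability at least $1-\delta$ over $S_0\sim\mathcal D^N$, $$\big|\mathrm{er}_{\mathcal D}[\bar f]-\widehat{\mathrm{er}}_S[\bar f]\big|\le\epsilon_k(S,\delta)\quad\text{for all } f\in\mathcal F_k;$$ (b) with probability at least $1-\delta$ over $S_0\sim\mathcal D^N$, every SRM predictor $f_S^{\mathrm{SRM}}$ for $S$ satisfies $$\mathrm{er}_{\mathcal D}[\bar f_S^{\mathrm{SRM}}]\le\inf_{f\in\mathcal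 F}\Big(\mathrm{er}_{\mathcal D}[\bar f]+2\,\epsilon_{k(f)}\Big(S,\frac{2\delta}{K+1}\Big)\Big).$$ Here "with probability at least $1-\delta$" means that the event contains a measurable event of probability at least $1-\delta$. -/

import Mathlib

open MeasureTheory
open scoped NNReal

noncomputable section

/-- The trajectory `t ↦ x_t(ξ)` of the system `x_{t+1} = fstar x_t` started at `x_0 = ξ`. -/
def trajectory {E : Type*} (fstar : E → E) (ξ : E) : ℕ → E :=
  fun t => fstar^[t] ξ

/-- The data set `S = {x_{0:T}(ξ_i)}_{i=1}^N` generated by the initial conditions `S0`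
(only the times `t ≤ T` of each trajectory are used below). -/
def dataset {E : Type*} {N : ℕ} (fstar : E → E) (S0 : Fin N → E) : Fin N → ℕ → E :=
  fun i => trajectory fstar (S0 i)

/-- The average loss `(1/T) ∑_{t<T} ℓ (f x_t - x_{t+1})` of the predictor `f`
along a trajectory `x`. -/
def trajLoss {E : Type*} [Sub E] (ℓ : E → ℝ) (T : ℕ) (f : E → E) (x : ℕ → E) : ℝ :=
  (1 / (T : ℝ)) * ∑ t ∈ Finset.range T, ℓ (f (x t) - x (t + 1))

/-- The true error (risk) of the predictor `f`. -/
def trueError {E : Type*} [Sub E] [MeasurableSpace E] (ℓ : E → ℝ) (fstar : E → E) (T : ℕ)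
    (D : Measure E) (f : E → E) : ℝ :=
  ∫ ξ, trajLoss ℓ T f (trajectory fstar ξ) ∂D

/-- The training error of the predictor `f` on the data set `S`. -/
def trainError {E : Type*} [Sub E] {N : ℕ} (ℓ : E → ℝ) (T : ℕ) (S : Fin N → ℕ → E)
    (f : E → E) : ℝ :=
  (1 / ((N : ℝ) * (T : ℝ))) *
    ∑ i, ∑ t ∈ Finset.range T, ℓ (f (S i t) - S i (t + 1))

open Classical in
/-- The clipped version of the predictor `f`, with values in the ball of radius `B`. -/
def clip {E : Type*} [NormedAddCommGroup E] [NormedSpace ℝ E] (B : ℝ) (f : E → E) : E → E :=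
  fun x => if B < ‖f x‖ then (B / ‖f x‖) • f x else f x

/-- The empirical Rademacher complexity of the class `G` of real functions with respect to the
sample `z`: the expectation, over a uniformly distributed sign vector `σ ∈ {-1, 1}^N`, of
`sup_{g ∈ G} (1/N) ∑ σ_i g(z_i)`. -/
def empRademacher {Z : Type*} {N : ℕ} (G : Set (Z → ℝ)) (z : Fin N → Z) : ℝ :=
  (1 / (2 : ℝ) ^ N) *
    ∑ σ : Fin N → ℤˣ, ⨆ g : G, (1 / (N : ℝ)) * ∑ i, (((σ i : ℤˣ) : ℤ) : ℝ) * g.1 (z i)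

/-- The class of `j`-th components of the clipped members of `Fk`. -/
def componentClass {n : ℕ} (B : ℝ)
    (Fk : Set (EuclideanSpace ℝ (Fin n) → EuclideanSpace ℝ (Fin n))) (j : Fin n) :
    Set (EuclideanSpace ℝ (Fin n) → ℝ) :=
  {g | ∃ f ∈ Fk, g = fun x => clip B f x j}

/-- The penalty `r_k(S) = (2 √2 L / T) ∑_{t<T} ∑_j R̂_{S_t}(F̄_{k,j})` of the class `Fk`. -/
def penalty {n N : ℕ} (L B : ℝ) (T : ℕ)
    (Fk : Set (EuclideanSpace ℝ (Fin n) → EuclideanSpace ℝ (Fin n)))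
    (S : Fin N → ℕ → EuclideanSpace ℝ (Fin n)) : ℝ :=
  (2 * Real.sqrt 2 * L / (T : ℝ)) *
    ∑ t ∈ Finset.range T, ∑ j : Fin n,
      empRademacher (componentClass B Fk j) (fun i => S i t)

/-- The bound `ε_k(S, δ) = r_k(S) + 6 L B √(log (4/δ) / (2N))`. -/
def errorBound {n N : ℕ} (L B : ℝ) (T : ℕ)
    (Fk : Set (EuclideanSpace ℝ (Fin n) → EuclideanSpace ℝ (Fin n)))
    (S : Fin N → ℕ → EuclideanSpace ℝ (Fin n)) (δ : ℝ) : ℝ :=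
  penalty L B T Fk S + 6 * L * B * Real.sqrt (Real.log (4 / δ) / (2 * (N : ℝ)))

/-- The union `F_1 ∪ … ∪ F_K`. -/
def unionClass {α : Type*} (K : ℕ) (F : ℕ → Set α) : Set α :=
  {f | ∃ k, 1 ≤ k ∧ k ≤ K ∧ f ∈ F k}

/-- The index `k(f) = min {k | f ∈ F_k}` with `1 ≤ k ≤ K`, for `f ∈ F_1 ∪ … ∪ F_K`. -/
def minIndex {α : Type*} (K : ℕ) (F : ℕ → Set α) (f : α) : ℕ :=
  sInf {k | 1 ≤ k ∧ k ≤ K ∧ f ∈ F k}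

/-- `f` is an SRM predictor for the data set `S`: for some `k` the pair `(k, f)` minimizes
`trainError (clip f) + r_k(S)` over all pairs with `1 ≤ k ≤ K` and `f ∈ F_k`. -/
def IsSRMPredictor {n N : ℕ} (ℓ : EuclideanSpace ℝ (Fin n) → ℝ) (L B : ℝ) (T K : ℕ)
    (F : ℕ → Set (EuclideanSpace ℝ (Fin n) → EuclideanSpace ℝ (Fin n)))
    (S : Fin N → ℕ → EuclideanSpace ℝ (Fin n))
    (f : EuclideanSpace ℝ (Fin n) → EuclideanSpace ℝ (Fin n)) : Prop :=
  ∃ k, 1 ≤ k ∧ k ≤ K ∧ f ∈ F k ∧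
    ∀ k', 1 ≤ k' → k' ≤ K → ∀ f' ∈ F k',
      trainError ℓ T S (clip B f) + penalty L B T (F k) S ≤
        trainError ℓ T S (clip B f') + penalty L B T (F k') S

/-- The class of functions `ξ ↦ (1/T) ∑_{t<T} ℓ (clip f (x_t(ξ)) - x_{t+1}(ξ))`, `f ∈ Fk`. -/
def lossClass {E : Type*} [NormedAddCommGroup E] [NormedSpace ℝ E] (ℓ : E → ℝ)
    (fstar : E → E) (B : ℝ) (T : ℕ) (Fk : Set (E → E)) : Set (E → ℝ) :=
  {g | ∃ f ∈ Fk, g = fun ξ => trajLoss ℓ T (clip B f) (trajectory fstar ξ)}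

/-- Measurability of a (possibly uncountable) class `G` for the law `D`: the supremum over `G`
of every signed sum `∑ σ_i g(z_i)`, `σ_i = ±1`, is a random variable of the i.i.d. sample `z`. -/
def IsMeasurableClass {Z : Type*} [MeasurableSpace Z] (D : Measure Z) (G : Set (Z → ℝ)) :
    Prop :=
  ∀ (m : ℕ) (σ : Fin m → ℤˣ),
    AEMeasurable (fun z : Fin m → Z => ⨆ g : G, ∑ i, (((σ i : ℤˣ) : ℤ) : ℝ) * g.1 (z i))
      (Measure.pi fun _ : Fin m => D)

/-- The event `A` has probability at least `p`; a possibly non-measurable `A` has to contain a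
measurable event of probability at least `p`. -/
def HasProbAtLeast {Ω : Type*} [MeasurableSpace Ω] (P : Measure Ω) (p : ℝ) (A : Set Ω) : Prop :=
  ∃ A', MeasurableSet A' ∧ A' ⊆ A ∧ ENNReal.ofReal p ≤ P A'

end

open ProbabilityTheory
open scoped BigOperators

/-! Almost surely all states stay in the ball of radius `B`, so the trajectory losses of clipped
predictors lie in `[0, M]` with `M = 2LB`. The core is a uniform deviation bound: for a class with
values in `[0, M]`, risk and training error differ by at most twice the empirical Rademacher
complexity plus a fluctuation term.

That bound takes a single concentration step. Let `Ψ z` be the mean, over a ghost sample `w`, of the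
supremum of `∑ g(w_i) - ∑ g(z_i)`, and let `R z` be the unnormalised empirical complexity. `Ψ`
dominates every deviation, and symmetrization gives mean at most `0` to `Ψ - 2R`. Changing one
sample point moves this function by at most `3M`, so McDiarmid
(`hasSubgaussianMGF_of_bounded_differences`) bounds its upper tail. Replacing `g` by `M - g` yields
the other side. Only signed suprema over finite samples are assumed measurable; hence the ghost
sample, and a lower integral that makes sense on every section.

The complexity of the loss class is reduced to the components of the predictors by Maurer's
contraction (`expect_signSum_iSup_le_sum`). Its factor `√2` is the sharp `L¹` Khintchine constant,
obtained from a Poincaré inequality on the cube in the manner of Latała and Oleszkiewicz.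

For the SRM predictor, a union bound makes the deviation bound hold for all classes at once. Passing
from risk to penalized training error, using minimality, and passing back gives the oracle
inequality. -/

/-! ### Fourier-type inequalities on the discrete cube and Khintchine's inequality. -/

theorem expect_finCons {α : Type*} [Fintype α] {n : ℕ} (f : (Fin (n + 1) → α) → ℝ) :
    𝔼 x, f x = 𝔼 y : Fin n → α, 𝔼 a : α, f (Fin.cons a y) := by
  rw [Finset.expect_comm, ← Finset.expect_product', Finset.univ_product_univ]
  exact (Fintype.expect_equiv (Fin.consEquiv fun _ => α) _ _ fun _ => rfl).symm

theorem expect_units_int (f : ℤˣ → ℝ) : 𝔼 s, f s = (f 1 + f (-1)) / 2 := by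
  rw [Fintype.expect_eq_sum_div_card]
  simp [Finset.sum_pair (show (1 : ℤˣ) ≠ -1 by decide)]

theorem expect_neg_arg {n : ℕ} (f : (Fin n → ℤˣ) → ℝ) : 𝔼 x, f (-x) = 𝔼 x, f x :=
  Fintype.expect_equiv (Equiv.neg _) _ _ fun _ => rfl

/-- The Dirichlet form of the random walk on the discrete cube. -/
noncomputable def cubeEnergy {n : ℕ} (f : (Fin n → ℤˣ) → ℝ) : ℝ :=
  ∑ i, 𝔼 x, ((f x - f (Function.update x i (-x i))) / 2) ^ 2

/-- The squared norm of the odd part of a function on the discrete cube. -/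
noncomputable def cubeOdd {n : ℕ} (f : (Fin n → ℤˣ) → ℝ) : ℝ :=
  𝔼 x, ((f x - f (-x)) / 2) ^ 2

theorem cubeOdd_nonneg {n : ℕ} (f : (Fin n → ℤˣ) → ℝ) : 0 ≤ cubeOdd f :=
  Finset.expect_nonneg fun _ _ => sq_nonneg _

theorem cubeEnergy_nonneg {n : ℕ} (f : (Fin n → ℤˣ) → ℝ) : 0 ≤ cubeEnergy f :=
  Finset.sum_nonneg fun _ _ => Finset.expect_nonneg fun _ _ => sq_nonneg _

/-- The average of a function on the cube over its first coordinate. -/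
noncomputable def headMean {n : ℕ} (f : (Fin (n + 1) → ℤˣ) → ℝ) (y : Fin n → ℤˣ) : ℝ :=
  (f (Fin.cons 1 y) + f (Fin.cons (-1) y)) / 2

/-- Half the increment of a function on the cube in its first coordinate. -/
noncomputable def headDiff {n : ℕ} (f : (Fin (n + 1) → ℤˣ) → ℝ) (y : Fin n → ℤˣ) : ℝ :=
  (f (Fin.cons 1 y) - f (Fin.cons (-1) y)) / 2

theorem expect_eq_headMean {n : ℕ} (f : (Fin (n + 1) → ℤˣ) → ℝ) :
    𝔼 x, f x = 𝔼 y, headMean f y := by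
  simp_rw [expect_finCons, expect_units_int, headMean]

theorem expect_sq_eq_head {n : ℕ} (f : (Fin (n + 1) → ℤˣ) → ℝ) :
    𝔼 x, f x ^ 2 = 𝔼 y, headMean f y ^ 2 + 𝔼 y, headDiff f y ^ 2 := by
  simp_rw [expect_finCons, expect_units_int, headMean, headDiff, ← Finset.expect_add_distrib]
  refine Finset.expect_congr rfl fun y _ => ?_
  ring

theorem cubeEnergy_eq_head {n : ℕ} (f : (Fin (n + 1) → ℤˣ) → ℝ) :
    cubeEnergy f =
      cubeEnergy (headMean f) + cubeEnergy (headDiff f) + 𝔼 y, headDiff f y ^ 2 := by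
  have h0 : 𝔼 x, ((f x - f (Function.update x 0 (-x 0))) / 2) ^ 2 = 𝔼 y, headDiff f y ^ 2 := by
    simp_rw [expect_finCons, expect_units_int, headDiff]
    refine Finset.expect_congr rfl fun y _ => ?_
    simp only [Fin.update_cons_zero, Fin.cons_zero, neg_neg]
    ring
  have hs : ∀ i : Fin n, 𝔼 x, ((f x - f (Function.update x i.succ (-x i.succ))) / 2) ^ 2 =
      𝔼 y, ((headMean f y - headMean f (Function.update y i (-y i))) / 2) ^ 2 +
      𝔼 y, ((headDiff f y - headDiff f (Function.update y i (-y i))) / 2) ^ 2 := by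
    intro i
    simp_rw [expect_finCons, expect_units_int, headDiff, headMean, ← Finset.expect_add_distrib]
    refine Finset.expect_congr rfl fun y _ => ?_
    simp only [← Fin.cons_update, Fin.cons_succ]
    ring
  simp only [cubeEnergy]
  rw [Fin.sum_univ_succ, h0]
  simp_rw [hs]
  rw [Finset.sum_add_distrib]
  ring

theorem neg_finCons {n : ℕ} (s : ℤˣ) (y : Fin n → ℤˣ) :
    -(Fin.cons s y : Fin (n + 1) → ℤˣ) = Fin.cons (-s) (-y) := by
  ext i
  refine Fin.cases ?_ (fun j => ?_) i <;> simp

/-- Write `f = m + x₀ d` with `m`, `d` independent of `x₀`. The factor `x₀` reverses parity, so the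
odd part of `f` consists of the odd part of `m` and the even part of `d`. -/
theorem cubeOdd_eq_head {n : ℕ} (f : (Fin (n + 1) → ℤˣ) → ℝ) :
    cubeOdd f = cubeOdd (headMean f) + 𝔼 y, headDiff f y ^ 2 - cubeOdd (headDiff f) := by
  have h : 𝔼 y, headDiff f y ^ 2 =
      𝔼 y, (headDiff f y ^ 2 + headDiff f (-y) ^ 2) / 2 := by
    rw [← Finset.expect_div, Finset.expect_add_distrib,
      expect_neg_arg (fun y => headDiff f y ^ 2)]
    ring
  rw [h]
  simp_rw [cubeOdd, expect_finCons, expect_units_int, neg_finCons,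
    ← Finset.expect_add_distrib, ← Finset.expect_sub_distrib, headMean, headDiff]
  refine Finset.expect_congr rfl fun y _ => ?_
  rw [neg_neg]
  ring

/-- In Walsh coefficients the energy weights the set `S` by `|S|`, and the odd part weights it by
`1` if `|S|` is odd and by `0` otherwise. The induction replaces the expansion. -/
theorem cubeOdd_le_cubeEnergy {n : ℕ} (f : (Fin n → ℤˣ) → ℝ) : cubeOdd f ≤ cubeEnergy f := by
  induction n with
  | zero =>
    have h : ∀ x : Fin 0 → ℤˣ, -x = x := fun _ => Subsingleton.elim _ _
    simp [cubeOdd, cubeEnergy, h]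
  | succ n ih =>
    rw [cubeOdd_eq_head, cubeEnergy_eq_head]
    linarith [ih (headMean f), cubeOdd_nonneg (headDiff f), cubeEnergy_nonneg (headDiff f)]

/-- A Poincaré inequality on the discrete cube, with the doubled spectral gap for even functions. -/
theorem two_mul_variance_le_cubeEnergy_add_cubeOdd {n : ℕ} (f : (Fin n → ℤˣ) → ℝ) :
    2 * (𝔼 x, f x ^ 2 - (𝔼 x, f x) ^ 2) ≤ cubeEnergy f + cubeOdd f := by
  induction n with
  | zero =>
    have h : 2 * (𝔼 x, f x ^ 2 - (𝔼 x, f x) ^ 2) = 0 := by simp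
    linarith [cubeOdd_nonneg f, cubeEnergy_nonneg f]
  | succ n ih =>
    rw [cubeOdd_eq_head, cubeEnergy_eq_head, expect_sq_eq_head, expect_eq_headMean]
    -- The increment contributes `2 𝔼 d²` on both sides; what remains of it is `cubeEnergy d -
    -- cubeOdd d ≥ 0`.
    linarith [ih (headMean f), cubeOdd_le_cubeEnergy (headDiff f)]

theorem expect_add_signSum_sq {n : ℕ} (v : Fin n → ℝ) (c : ℝ) :
    𝔼 x : Fin n → ℤˣ, (c + ∑ i, ((x i : ℤ) : ℝ) * v i) ^ 2 = c ^ 2 + ∑ i, v i ^ 2 := by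
  induction n generalizing c with
  | zero => simp
  | succ n ih =>
    rw [expect_finCons, Finset.expect_comm, expect_units_int]
    simp only [Fin.sum_univ_succ, Fin.cons_zero, Fin.cons_succ, ← add_assoc]
    rw [ih, ih]
    push_cast
    simp
    ring

/-- **Khintchine's inequality** in `L¹`, with the optimal constant `√2`. -/
theorem sqrt_sum_sq_le_expect_abs_signSum {n : ℕ} (v : Fin n → ℝ) :
    √(∑ i, v i ^ 2) ≤ √2 * 𝔼 x : Fin n → ℤˣ, |∑ i, ((x i : ℤ) : ℝ) * v i| := by
  set f : (Fin n → ℤˣ) → ℝ := fun x => |∑ i, ((x i : ℤ) : ℝ) * v i| with hf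
  have hodd : cubeOdd f = 0 := by
    have : ∀ x, f (-x) = f x := by
      intro x
      simp only [hf, Pi.neg_apply, Units.val_neg, Int.cast_neg, neg_mul, Finset.sum_neg_distrib,
        abs_neg]
    simp [cubeOdd, this]
  have hinv : ∀ i, 𝔼 x, f (Function.update x i (-x i)) ^ 2 = 𝔼 x, f x ^ 2 := by
    intro i
    have hinvol : Function.Involutive
        (fun x : Fin n → ℤˣ => Function.update x i (-x i)) := by
      intro x; simp
    exact Fintype.expect_equiv hinvol.toPerm _ _ fun _ => rfl
  have hflip : ∀ x i, f (Function.update x i (-x i)) =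
      |(∑ j, ((x j : ℤ) : ℝ) * v j) - 2 * (((x i : ℤ) : ℝ) * v i)| := by
    intro x i
    simp only [hf]
    congr 1
    rw [← Finset.add_sum_erase _ _ (Finset.mem_univ i),
      ← Finset.add_sum_erase (a := i) _ (fun j => ((x j : ℤ) : ℝ) * v j) (Finset.mem_univ i)]
    have : ∑ j ∈ Finset.univ.erase i, (((Function.update x i (-x i) j : ℤˣ) : ℤ) : ℝ) * v j =
        ∑ j ∈ Finset.univ.erase i, ((x j : ℤ) : ℝ) * v j := by
      refine Finset.sum_congr rfl fun j hj => ?_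
      rw [Function.update_of_ne (Finset.ne_of_mem_erase hj)]
    rw [this]
    simp
    ring
  -- Triangle inequality: the signed sums after each of the `n` single flips add up to `n - 2` times
  -- the original one.
  have hsum : ∀ x, ((n : ℝ) - 2) * f x ≤ ∑ i, f (Function.update x i (-x i)) := by
    intro x
    simp_rw [hflip]
    refine le_trans ?_ (Finset.abs_sum_le_sum_abs _ _)
    rw [Finset.sum_sub_distrib, ← Finset.mul_sum]
    simp only [Finset.sum_const, Finset.card_univ, Fintype.card_fin, nsmul_eq_mul, hf]
    rw [← sub_mul, abs_mul]
    exact mul_le_mul_of_nonneg_right (le_abs_self _) (abs_nonneg _)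
  have henergy : cubeEnergy f ≤ 𝔼 x, f x ^ 2 := by
    have h1 : ∀ i, 𝔼 x, ((f x - f (Function.update x i (-x i))) / 2) ^ 2 =
        (𝔼 x, f x ^ 2 - 𝔼 x, f x * f (Function.update x i (-x i))) / 2 := by
      intro i
      have h2 : 𝔼 x, f x ^ 2 =
          𝔼 x, (f x ^ 2 + f (Function.update x i (-x i)) ^ 2) / 2 := by
        rw [← Finset.expect_div, Finset.expect_add_distrib, hinv]
        ring
      rw [h2, ← Finset.expect_sub_distrib, Finset.expect_div]
      refine Finset.expect_congr rfl fun x _ => ?_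
      ring
    have h3 : ((n : ℝ) - 2) * 𝔼 x, f x ^ 2 ≤
        ∑ i, 𝔼 x, f x * f (Function.update x i (-x i)) := by
      rw [← Finset.expect_sum_comm, Finset.mul_expect]
      refine Finset.expect_le_expect fun x _ => ?_
      rw [← Finset.mul_sum]
      nlinarith [hsum x, abs_nonneg (∑ i, ((x i : ℤ) : ℝ) * v i)]
    simp only [cubeEnergy, h1]
    rw [← Finset.sum_div, Finset.sum_sub_distrib]
    simp only [Finset.sum_const, Finset.card_univ, Fintype.card_fin, nsmul_eq_mul]
    linarith
  have hsq : 𝔼 x, f x ^ 2 = ∑ i, v i ^ 2 := by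
    have := expect_add_signSum_sq v 0
    simpa [hf, sq_abs] using this
  have hmain := two_mul_variance_le_cubeEnergy_add_cubeOdd f
  have hpos : 0 ≤ 𝔼 x, f x := Finset.expect_nonneg fun _ _ => abs_nonneg _
  rw [← Real.sqrt_sq hpos, ← Real.sqrt_mul (by norm_num)]
  refine Real.sqrt_le_sqrt ?_
  rw [← hsq]
  -- With no odd part and energy at most `𝔼 f²`, the Poincaré inequality reads `2 (𝔼 f² - (𝔼 f)²) ≤
  -- 𝔼 f²`, that is `𝔼 f² ≤ 2 (𝔼 f)²`.
  linarith

/-! ### Vector contraction for Rademacher averages. -/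

theorem bddAbove_range_add {ι : Sort*} {f g : ι → ℝ} (hf : BddAbove (Set.range f))
    (hg : BddAbove (Set.range g)) : BddAbove (Set.range fun i => f i + g i) := by
  obtain ⟨a, ha⟩ := hf
  obtain ⟨b, hb⟩ := hg
  refine ⟨a + b, ?_⟩
  rintro _ ⟨i, rfl⟩
  exact add_le_add (ha ⟨i, rfl⟩) (hb ⟨i, rfl⟩)

theorem bddAbove_range_sum {ι : Sort*} {κ : Type*} (s : Finset κ) {f : κ → ι → ℝ}
    (hf : ∀ k ∈ s, BddAbove (Set.range (f k))) :
    BddAbove (Set.range fun i => ∑ k ∈ s, f k i) := by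
  choose! c hc using hf
  refine ⟨∑ k ∈ s, c k, ?_⟩
  rintro _ ⟨i, rfl⟩
  exact Finset.sum_le_sum fun k hk => hc k hk ⟨i, rfl⟩

theorem abs_units_int_cast (s : ℤˣ) : |((s : ℤ) : ℝ)| = 1 := by
  rcases Int.units_eq_one_or s with rfl | rfl <;> simp

theorem bddAbove_range_sign_mul {ι : Sort*} {f : ι → ℝ} {C : ℝ} (hf : ∀ i, |f i| ≤ C)
    (s : ℤˣ) : BddAbove (Set.range fun i => ((s : ℤ) : ℝ) * f i) := by
  refine ⟨C, ?_⟩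
  rintro _ ⟨i, rfl⟩
  refine (le_abs_self _).trans ?_
  rw [abs_mul, abs_units_int_cast, one_mul]
  exact hf i

theorem bddAbove_range_signSum {ι : Sort*} {κ : Type*} [Fintype κ] {f : κ → ι → ℝ} {C : ℝ}
    (hf : ∀ k i, |f k i| ≤ C) (s : κ → ℤˣ) :
    BddAbove (Set.range fun i => ∑ k, ((s k : ℤ) : ℝ) * f k i) :=
  bddAbove_range_sum _ fun k _ => bddAbove_range_sign_mul (hf k) (s k)

/-- One step of the vector contraction inequality. -/
theorem expect_sign_iSup_le {ι : Type*} [Nonempty ι] {n : ℕ} {a u : ι → ℝ}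
    {v : Fin n → ι → ℝ} {C L : ℝ} (ha : BddAbove (Set.range a)) (hv : ∀ j f, |v j f| ≤ C)
    (hL : 0 ≤ L) (huv : ∀ f g, |u f - u g| ≤ L * √(∑ j, (v j f - v j g) ^ 2)) :
    𝔼 s : ℤˣ, ⨆ f, (a f + ((s : ℤ) : ℝ) * u f) ≤
      𝔼 x : Fin n → ℤˣ, ⨆ f, (a f + √2 * L * ∑ j, ((x j : ℤ) : ℝ) * v j f) := by
  set Φ : (Fin n → ℤˣ) → ℝ := fun x => ⨆ f, (a f + √2 * L * ∑ j, ((x j : ℤ) : ℝ) * v j f)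
    with hΦ
  have hc : 0 ≤ √2 * L := by positivity
  have hbdd : ∀ x : Fin n → ℤˣ,
      BddAbove (Set.range fun f => a f + √2 * L * ∑ j, ((x j : ℤ) : ℝ) * v j f) := by
    intro x
    refine bddAbove_range_add ha ?_
    obtain ⟨b, hb⟩ := bddAbove_range_signSum hv x
    refine ⟨√2 * L * b, ?_⟩
    rintro _ ⟨f, rfl⟩
    exact mul_le_mul_of_nonneg_left (hb ⟨f, rfl⟩) hc
  -- Averaging over one sign is half a supremum over pairs `(f, g)`, so it suffices to bound each
  -- pair. Khintchine turns the Euclidean distance into a mean of `|∑ x_j (v_j f - v_j g)|`.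
  have hpair : ∀ f g, (a f + u f) + (a g - u g) ≤ 2 * 𝔼 x, Φ x := by
    intro f g
    have h1 : u f - u g ≤
        √2 * L * 𝔼 x : Fin n → ℤˣ, |∑ j, ((x j : ℤ) : ℝ) * (v j f - v j g)| := by
      refine (le_abs_self _).trans ((huv f g).trans ?_)
      rw [mul_comm (√2) L, mul_assoc]
      exact mul_le_mul_of_nonneg_left
        (sqrt_sum_sq_le_expect_abs_signSum fun j => v j f - v j g) hL
    have h2 : a f + a g + √2 * L *
        𝔼 x : Fin n → ℤˣ, |∑ j, ((x j : ℤ) : ℝ) * (v j f - v j g)| ≤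
          𝔼 x, (Φ x + Φ (-x)) := by
      rw [Finset.mul_expect, ← Fintype.expect_const (ι := Fin n → ℤˣ) (a f + a g),
        ← Finset.expect_add_distrib]
      refine Finset.expect_le_expect fun x _ => ?_
      have e : ∀ f, ∑ j, (((-x) j : ℤ) : ℝ) * v j f = -∑ j, ((x j : ℤ) : ℝ) * v j f := by
        intro f
        simp only [Pi.neg_apply, Units.val_neg, Int.cast_neg, neg_mul, Finset.sum_neg_distrib]
      have hle : ∀ (x : Fin n → ℤˣ) f,
          a f + √2 * L * ∑ j, ((x j : ℤ) : ℝ) * v j f ≤ Φ x :=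
        fun x f => le_ciSup (hbdd x) f
      have a1 := hle x f
      have a2 := hle x g
      have a3 := hle (-x) f
      have a4 := hle (-x) g
      rw [e] at a3 a4
      simp_rw [mul_sub, Finset.sum_sub_distrib]
      -- The sign of the difference decides which of `f`, `g` is tested in `Φ x` and which in `Φ
      -- (-x)`.
      rcases abs_cases (∑ j, ((x j : ℤ) : ℝ) * v j f - ∑ j, ((x j : ℤ) : ℝ) * v j g)
        with ⟨h, _⟩ | ⟨h, _⟩ <;> rw [h] <;> linarith
    rw [Finset.expect_add_distrib, expect_neg_arg Φ] at h2
    linarith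
  rw [expect_units_int]
  have h3 : ∀ g, ⨆ f, (a f + u f) ≤ 2 * 𝔼 x, Φ x - (a g - u g) :=
    fun g => ciSup_le fun f => by linarith [hpair f g]
  have h4 : ⨆ g, (a g - u g) ≤ 2 * 𝔼 x, Φ x - ⨆ f, (a f + u f) :=
    ciSup_le fun g => by linarith [h3 g]
  simp only [Units.val_one, Int.cast_one, one_mul, Units.val_neg, Int.cast_neg, neg_mul,
    ← sub_eq_add_neg]
  linarith

/-- **Maurer's vector contraction inequality**, with an offset. -/
theorem expect_signSum_iSup_le {ι : Type*} [Nonempty ι] {N n : ℕ} {a : ι → ℝ}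
    {u : Fin N → ι → ℝ} {v : Fin N → Fin n → ι → ℝ} {C L : ℝ}
    (ha : BddAbove (Set.range a)) (hu : ∀ i f, |u i f| ≤ C) (hv : ∀ i j f, |v i j f| ≤ C)
    (hL : 0 ≤ L) (huv : ∀ i f g, |u i f - u i g| ≤ L * √(∑ j, (v i j f - v i j g) ^ 2)) :
    𝔼 s : Fin N → ℤˣ, ⨆ f, (a f + ∑ i, ((s i : ℤ) : ℝ) * u i f) ≤
      𝔼 x : Fin N → Fin n → ℤˣ,
        ⨆ f, (a f + ∑ i, √2 * L * ∑ j, ((x i j : ℤ) : ℝ) * v i j f) := by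
  induction N generalizing a with
  | zero => simp
  | succ N ih =>
    rw [expect_finCons, expect_finCons]
    calc 𝔼 s : Fin N → ℤˣ, 𝔼 t : ℤˣ, ⨆ f,
          (a f + ∑ i, (((Fin.cons t s : Fin (N + 1) → ℤˣ) i : ℤ) : ℝ) * u i f)
        ≤ 𝔼 s : Fin N → ℤˣ, 𝔼 y : Fin n → ℤˣ, ⨆ f,
          ((a f + √2 * L * ∑ j, ((y j : ℤ) : ℝ) * v 0 j f) +
            ∑ i : Fin N, ((s i : ℤ) : ℝ) * u i.succ f) := by
          refine Finset.expect_le_expect fun s _ => ?_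
          -- The offset does the bookkeeping: here it carries the untreated signs, and in the later
          -- use of `ih` the coordinate already contracted.
          have := expect_sign_iSup_le (a := fun f => a f + ∑ i : Fin N, ((s i : ℤ) : ℝ) * u i.succ f)
            (u := u 0) (v := v 0) (bddAbove_range_add ha
              (bddAbove_range_signSum (fun i f => hu i.succ f) s)) (hv 0) hL (huv 0)
          refine (le_of_eq ?_).trans (this.trans (le_of_eq ?_))
          · refine Finset.expect_congr rfl fun t _ => ?_
            congr 1
            ext f
            rw [Fin.sum_univ_succ, Fin.cons_zero]
            simp only [Fin.cons_succ]
            ring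
          · refine Finset.expect_congr rfl fun t _ => ?_
            congr 1
            ext f
            ring
      _ = 𝔼 y : Fin n → ℤˣ, 𝔼 s : Fin N → ℤˣ, ⨆ f,
          ((a f + √2 * L * ∑ j, ((y j : ℤ) : ℝ) * v 0 j f) +
            ∑ i : Fin N, ((s i : ℤ) : ℝ) * u i.succ f) := Finset.expect_comm _ _ _
      _ ≤ 𝔼 y : Fin n → ℤˣ, 𝔼 x : Fin N → Fin n → ℤˣ, ⨆ f,
          ((a f + √2 * L * ∑ j, ((y j : ℤ) : ℝ) * v 0 j f) +
            ∑ i : Fin N, √2 * L * ∑ j, ((x i j : ℤ) : ℝ) * v i.succ j f) := by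
          refine Finset.expect_le_expect fun y _ => ?_
          refine ih (bddAbove_range_add ha ?_) (fun i => hu i.succ) (fun i => hv i.succ)
            fun i => huv i.succ
          obtain ⟨b, hb⟩ := bddAbove_range_signSum (hv 0) y
          refine ⟨√2 * L * b, ?_⟩
          rintro _ ⟨f, rfl⟩
          exact mul_le_mul_of_nonneg_left (hb ⟨f, rfl⟩) (by positivity)
      _ = _ := by
          rw [Finset.expect_comm]
          refine Finset.expect_congr rfl fun x _ => Finset.expect_congr rfl fun y _ => ?_
          congr 1
          ext f
          rw [Fin.sum_univ_succ, Fin.cons_zero]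
          simp only [Fin.cons_succ]
          ring

theorem expect_comp_eval {α κ : Type*} [Fintype α] [Nonempty α] [Fintype κ] [DecidableEq κ]
    (φ : α → ℝ) (j : κ) : 𝔼 x : κ → α, φ (x j) = 𝔼 a, φ a := by
  rw [Fintype.expect_equiv (Equiv.funSplitAt j α) (fun x => φ (x j)) (fun p => φ p.1)
    fun x => rfl, ← Finset.univ_product_univ,
    Finset.expect_product' Finset.univ Finset.univ fun a (_ : {i // i ≠ j} → α) => φ a]
  simp

/-- The expected signed supremum of a family of Lipschitz images of vectors is controlled by those
of the components of these vectors. -/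
theorem expect_signSum_iSup_le_sum {ι : Type*} [Nonempty ι] {N n : ℕ}
    {u : Fin N → ι → ℝ} {v : Fin N → Fin n → ι → ℝ} {C L : ℝ}
    (hu : ∀ i f, |u i f| ≤ C) (hv : ∀ i j f, |v i j f| ≤ C)
    (hL : 0 ≤ L) (huv : ∀ i f g, |u i f - u i g| ≤ L * √(∑ j, (v i j f - v i j g) ^ 2)) :
    𝔼 s : Fin N → ℤˣ, ⨆ f, ∑ i, ((s i : ℤ) : ℝ) * u i f ≤
      √2 * L * ∑ j, 𝔼 s : Fin N → ℤˣ, ⨆ f, ∑ i, ((s i : ℤ) : ℝ) * v i j f := by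
  have h := expect_signSum_iSup_le (a := fun _ : ι => (0 : ℝ)) (u := u) (v := v)
    ⟨0, by rintro _ ⟨_, rfl⟩; exact le_rfl⟩ hu hv hL huv
  simp only [zero_add] at h
  refine h.trans ?_
  have hmarg : ∀ j, 𝔼 s : Fin N → ℤˣ, ⨆ f, ∑ i, ((s i : ℤ) : ℝ) * v i j f =
      𝔼 x : Fin N → Fin n → ℤˣ, ⨆ f, ∑ i, ((x i j : ℤ) : ℝ) * v i j f := by
    intro j
    rw [Fintype.expect_equiv (Equiv.piComm fun _ _ => ℤˣ)
      (fun x : Fin N → Fin n → ℤˣ => ⨆ f, ∑ i, ((x i j : ℤ) : ℝ) * v i j f)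
      (fun y : Fin n → Fin N → ℤˣ => ⨆ f, ∑ i, ((y j i : ℤ) : ℝ) * v i j f) fun _ => rfl]
    exact (expect_comp_eval
      (fun s : Fin N → ℤˣ => ⨆ f, ∑ i, ((s i : ℤ) : ℝ) * v i j f) j).symm
  simp_rw [hmarg]
  rw [← Finset.expect_sum_comm, Finset.mul_expect]
  -- Subadditivity of the supremum over `j`; each column of the uniform sign matrix is itself a
  -- uniform sign vector.
  refine Finset.expect_le_expect fun x _ => ciSup_le fun f => ?_
  rw [← Finset.mul_sum, Finset.sum_comm]
  refine mul_le_mul_of_nonneg_left (Finset.sum_le_sum fun j _ => ?_) (by positivity)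
  exact le_ciSup (bddAbove_range_signSum (fun i f => hv i j f) fun i => x i j) f

/-! ### Lower integrals of bounded functions. -/

/-- The lower integral of a function with values in `[-C, C]` that need not be measurable. -/
noncomputable def lowerMean {α : Type*} [MeasurableSpace α] (μ : Measure α) (C : ℝ)
    (f : α → ℝ) : ℝ :=
  (∫⁻ x, ENNReal.ofReal (f x + C) ∂μ).toReal - C

section LowerMean

variable {α β : Type*} [MeasurableSpace α] [MeasurableSpace β] {μ : Measure α} {ν : Measure β}
  {C : ℝ}

theorem integrable_of_abs_le [IsFiniteMeasure μ] {f : α → ℝ} (hf : AEMeasurable f μ)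
    (hC : ∀ x, |f x| ≤ C) : Integrable f μ :=
  Integrable.of_bound hf.aestronglyMeasurable C (Filter.Eventually.of_forall hC)

theorem lowerMean_eq_integral [IsProbabilityMeasure μ] {f : α → ℝ} (hf : AEMeasurable f μ)
    (hC : ∀ x, |f x| ≤ C) : lowerMean μ C f = ∫ x, f x ∂μ := by
  rw [lowerMean, ← integral_eq_lintegral_of_nonneg_ae, integral_add (integrable_of_abs_le hf hC)
    (integrable_const C)]
  · simp
  · exact Filter.Eventually.of_forall fun x => by
      have := (abs_le.1 (hC x)).1
      simp only [Pi.zero_apply]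
      linarith
  · exact (hf.add_const C).aestronglyMeasurable

theorem lintegral_ofReal_add_le [IsProbabilityMeasure μ] {f : α → ℝ} (hC : ∀ x, f x ≤ C) :
    ∫⁻ x, ENNReal.ofReal (f x + C) ∂μ ≤ ENNReal.ofReal (C + C) := by
  refine (lintegral_mono fun x =>
    ENNReal.ofReal_le_ofReal (add_le_add_left (hC x) C)).trans (le_of_eq ?_)
  simp

/-- The lower integral is monotone and commutes with adding constants, with no measurability needed.
So bounded differences survive partial integration at every point, whereas the Bochner integral
takes the value `0` on a nonintegrable section. -/
theorem lowerMean_le_add [IsProbabilityMeasure μ] {f g : α → ℝ} {c : ℝ} (hc : 0 ≤ c)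
    (hg : ∀ x, g x ≤ C) (hfg : ∀ x, f x ≤ g x + c) : lowerMean μ C f ≤ lowerMean μ C g + c := by
  have hfin := (lintegral_ofReal_add_le (μ := μ) hg).trans_lt ENNReal.ofReal_lt_top
  have h : ∫⁻ x, ENNReal.ofReal (f x + C) ∂μ ≤
      ∫⁻ x, ENNReal.ofReal (g x + C) ∂μ + ENNReal.ofReal c := by
    calc ∫⁻ x, ENNReal.ofReal (f x + C) ∂μ
        ≤ ∫⁻ x, (ENNReal.ofReal (g x + C) + ENNReal.ofReal c) ∂μ := by
          refine lintegral_mono fun x => ?_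
          refine (ENNReal.ofReal_le_ofReal ?_).trans ENNReal.ofReal_add_le
          linarith [hfg x]
      _ = _ := by rw [lintegral_add_right _ measurable_const]; simp
  have h2 := ENNReal.toReal_mono (ENNReal.add_ne_top.2 ⟨hfin.ne, ENNReal.ofReal_ne_top⟩) h
  rw [ENNReal.toReal_add hfin.ne ENNReal.ofReal_ne_top, ENNReal.toReal_ofReal hc] at h2
  simp only [lowerMean]
  linarith

theorem abs_lowerMean_le [IsProbabilityMeasure μ] {f : α → ℝ} (hC : ∀ x, |f x| ≤ C) :
    |lowerMean μ C f| ≤ C := by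
  obtain ⟨x⟩ := μ.nonempty_of_neZero
  have hC0 : 0 ≤ C := (abs_nonneg _).trans (hC x)
  have h := ENNReal.toReal_mono ENNReal.ofReal_ne_top
    (lintegral_ofReal_add_le (μ := μ) fun x => (abs_le.1 (hC x)).2)
  rw [ENNReal.toReal_ofReal (by linarith)] at h
  have h0 := ENNReal.toReal_nonneg (a := ∫⁻ x, ENNReal.ofReal (f x + C) ∂μ)
  rw [abs_le, lowerMean]
  constructor <;> linarith

theorem integral_le_lowerMean [IsProbabilityMeasure μ] {f g : α → ℝ} (hf : AEMeasurable f μ)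
    (hfC : ∀ x, |f x| ≤ C) (hgC : ∀ x, g x ≤ C) (hfg : ∀ x, f x ≤ g x) :
    ∫ x, f x ∂μ ≤ lowerMean μ C g := by
  rw [← lowerMean_eq_integral hf hfC]
  simpa using lowerMean_le_add le_rfl hgC fun x => (hfg x).trans_eq (add_zero _).symm

theorem aemeasurable_lowerMean [SFinite ν] {f : α × β → ℝ} (hf : AEMeasurable f (μ.prod ν)) :
    AEMeasurable (fun x => lowerMean ν C fun y => f (x, y)) μ :=
  ((hf.add_const C).ennreal_ofReal.lintegral_prod_right').ennreal_toReal.sub_const C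

theorem lowerMean_ae_eq_integral [SFinite μ] [IsProbabilityMeasure ν] {f : α × β → ℝ}
    (hf : AEMeasurable f (μ.prod ν)) (hC : ∀ p, |f p| ≤ C) :
    (fun x => lowerMean ν C fun y => f (x, y)) =ᵐ[μ] fun x => ∫ y, f (x, y) ∂ν := by
  filter_upwards [hf.aestronglyMeasurable.prodMk_left] with x hx
  exact lowerMean_eq_integral hx.aemeasurable fun y => hC _

theorem integral_lowerMean [IsProbabilityMeasure μ] [IsProbabilityMeasure ν] {f : α × β → ℝ}
    (hf : AEMeasurable f (μ.prod ν)) (hC : ∀ p, |f p| ≤ C) :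
    ∫ x, lowerMean ν C (fun y => f (x, y)) ∂μ = ∫ p, f p ∂μ.prod ν := by
  rw [integral_prod _ (integrable_of_abs_le hf hC)]
  exact integral_congr_ae (lowerMean_ae_eq_integral hf hC)

end LowerMean

/-! ### McDiarmid's inequality. -/

theorem measurePreserving_finCons {Z : Type*} [MeasurableSpace Z] (D : Measure Z)
    [IsProbabilityMeasure D] (n : ℕ) :
    MeasurePreserving (fun p : (Fin n → Z) × Z => (Fin.cons p.2 p.1 : Fin (n + 1) → Z))
      ((Measure.pi fun _ => D).prod D) (Measure.pi fun _ => D) := by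
  have h := (measurePreserving_piFinSuccAbove (fun _ : Fin (n + 1) => D) 0).symm.comp
    (Measure.measurePreserving_swap (μ := Measure.pi fun _ : Fin n => D) (ν := D))
  convert h using 1
  ext p i
  simp [MeasurableEquiv.piFinSuccAbove_symm_apply]

/-- **McDiarmid's inequality**: a function of independent random variables with bounded
differences is sub-Gaussian. -/
theorem hasSubgaussianMGF_of_bounded_differences {Z : Type*} [MeasurableSpace Z] {D : Measure Z}
    [IsProbabilityMeasure D] {n : ℕ} {F : (Fin n → Z) → ℝ} {C : ℝ} {c : ℝ≥0}
    (hF : AEMeasurable F (Measure.pi fun _ => D)) (hC : ∀ z, |F z| ≤ C)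
    (hc : ∀ z i x, F z ≤ F (Function.update z i x) + c) :
    HasSubgaussianMGF (fun z => F z - ∫ w, F w ∂Measure.pi fun _ => D) (n * (c / 2) ^ 2)
      (Measure.pi fun _ => D) := by
  obtain ⟨z₀⟩ := D.nonempty_of_neZero
  have hint : ∀ {n : ℕ} {F : (Fin n → Z) → ℝ} (_ : AEMeasurable F (Measure.pi fun _ => D))
      (_ : ∀ z, |F z| ≤ C) (a t : ℝ),
      Integrable (fun z => Real.exp (t * (F z - a))) (Measure.pi fun _ => D) := by
    intro n F hF hC a t
    refine Integrable.of_bound (C := Real.exp (|t| * (C + |a|)))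
      (((hF.sub_const a).const_mul t).exp.aestronglyMeasurable)
      (Filter.Eventually.of_forall fun z => ?_)
    rw [Real.norm_eq_abs, Real.abs_exp, Real.exp_le_exp]
    refine (le_abs_self _).trans ?_
    rw [abs_mul]
    refine mul_le_mul_of_nonneg_left ?_ (abs_nonneg t)
    exact (abs_sub _ _).trans (add_le_add_left (hC z) _)
  refine ⟨hint hF hC _, ?_⟩
  induction n with
  | zero =>
    intro t
    have h : ∀ z : Fin 0 → Z, F z = F default := fun z => congrArg F (Subsingleton.elim _ _)
    simp [mgf, h]
  | succ n ih =>
    intro t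
    set P : Measure (Fin n → Z) := Measure.pi fun _ => D with hP
    have hmp := measurePreserving_finCons D n
    have hF' : AEMeasurable (fun p : (Fin n → Z) × Z => F (Fin.cons p.2 p.1)) (P.prod D) :=
      hF.comp_quasiMeasurePreserving hmp.quasiMeasurePreserving
    -- Integrating out the first variable keeps the mean, the bound `C` and the differences `c`, so
    -- the induction hypothesis applies to `G`. Sections of `F` are known to be a.e. measurable only
    -- for almost every `y`.
    set G : (Fin n → Z) → ℝ := fun y => lowerMean D C fun x => F (Fin.cons x y) with hGdef
    have hG : AEMeasurable G P := aemeasurable_lowerMean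
      (f := fun p : (Fin n → Z) × Z => F (Fin.cons p.2 p.1)) hF'
    have hGC : ∀ y, |G y| ≤ C := fun y => abs_lowerMean_le fun x => hC _
    have hGc : ∀ z i x, G z ≤ G (Function.update z i x) + c := by
      intro z i x
      refine lowerMean_le_add c.2 (fun w => (abs_le.1 (hC _)).2) fun w => ?_
      have := hc (Fin.cons w z) i.succ x
      rwa [← Fin.cons_update] at this
    have hEG : ∫ y, G y ∂P = ∫ w, F w ∂Measure.pi fun _ => D := by
      rw [← hmp.map_eq, integral_map hmp.aemeasurable (by rw [hmp.map_eq]; exact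
        hF.aestronglyMeasurable)]
      exact integral_lowerMean
        (f := fun p : (Fin n → Z) × Z => F (Fin.cons p.2 p.1)) hF' fun p => hC _
    have hih := ih hG hGC hGc t
    set E := ∫ w, F w ∂Measure.pi fun _ => D with hE
    have hexp := hint hF hC E t
    have h1 : mgf (fun z => F z - E) (Measure.pi fun _ => D) t =
        ∫ y, ∫ x, Real.exp (t * (F (Fin.cons x y) - E)) ∂D ∂P := by
      rw [mgf, ← integral_prod (fun p : (Fin n → Z) × Z => Real.exp (t * (F (Fin.cons p.2 p.1) - E)))
        (hmp.integrable_comp_of_integrable hexp)]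
      conv_lhs => rw [← hmp.map_eq]
      rw [integral_map hmp.aemeasurable (by rw [hmp.map_eq]; exact hexp.aestronglyMeasurable)]
    have hinner : ∀ᵐ y ∂P, ∫ x, Real.exp (t * (F (Fin.cons x y) - E)) ∂D ≤
        Real.exp ((c / 2) ^ 2 * t ^ 2 / 2) * Real.exp (t * (G y - E)) := by
      filter_upwards [hF'.aestronglyMeasurable.prodMk_left] with y hy
      have hGy : G y = ∫ x, F (Fin.cons x y) ∂D :=
        lowerMean_eq_integral hy.aemeasurable fun x => hC _
      have hbdd : BddBelow (Set.range fun x => F (Fin.cons x y)) :=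
        ⟨-C, by rintro _ ⟨x, rfl⟩; exact (abs_le.1 (hC _)).1⟩
      have hne : Nonempty Z := ⟨z₀⟩
      -- A section has oscillation at most `c`, so Hoeffding's lemma on an interval of length `c`
      -- contributes `(c / 2) ^ 2`.
      have hIcc : ∀ᵐ x ∂D, F (Fin.cons x y) ∈
          Set.Icc (⨅ x, F (Fin.cons x y)) ((⨅ x, F (Fin.cons x y)) + c) := by
        refine Filter.Eventually.of_forall fun x => ⟨ciInf_le hbdd x, ?_⟩
        rw [← sub_le_iff_le_add]
        refine le_ciInf fun x' => ?_
        have := hc (Fin.cons x y) 0 x'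
        rw [Fin.update_cons_zero] at this
        linarith
      have hsub := (hasSubgaussianMGF_of_mem_Icc hy.aemeasurable hIcc).mgf_le t
      rw [← hGy] at hsub
      have hcast : (((‖(⨅ x, F (Fin.cons x y)) + (c : ℝ) - ⨅ x, F (Fin.cons x y)‖₊ / 2) ^ 2 :
          ℝ≥0) : ℝ) = ((c : ℝ) / 2) ^ 2 := by
        simp
      rw [hcast, mgf] at hsub
      calc ∫ x, Real.exp (t * (F (Fin.cons x y) - E)) ∂D
          = ∫ x, Real.exp (t * (F (Fin.cons x y) - G y)) * Real.exp (t * (G y - E)) ∂D := by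
            refine integral_congr_ae (Filter.Eventually.of_forall fun x => ?_)
            simp only [← Real.exp_add]
            ring_nf
        _ ≤ _ := by
            rw [integral_mul_const]
            exact mul_le_mul_of_nonneg_right hsub (Real.exp_pos _).le
    rw [h1]
    refine (integral_mono_of_nonneg (Filter.Eventually.of_forall fun y =>
      integral_nonneg fun x => (Real.exp_pos _).le)
      ((hint hG hGC E t).const_mul _) hinner).trans ?_
    rw [integral_const_mul]
    rw [hEG, mgf] at hih
    refine (mul_le_mul_of_nonneg_left hih (Real.exp_pos _).le).trans_eq ?_
    rw [← Real.exp_add]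
    congr 1
    push_cast
    ring

/-! ### Signed suprema and symmetrization. -/

/-- The supremum, over a family of functions, of the signed sum of their values on a sample. -/
noncomputable def signSup {Z ι κ : Type*} [Fintype κ] (g : ι → Z → ℝ) (σ : κ → ℤˣ)
    (z : κ → Z) : ℝ :=
  ⨆ f, ∑ a, ((σ a : ℤ) : ℝ) * g f (z a)

section SignSup

variable {Z ι κ κ' : Type*} [Fintype κ] [Fintype κ'] {g : ι → Z → ℝ} {M : ℝ}

theorem signSup_comp_equiv (e : κ' ≃ κ) (σ : κ → ℤˣ) (z : κ → Z) :
    signSup g (σ ∘ e) (z ∘ e) = signSup g σ z := by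
  simp only [signSup, Function.comp_apply]
  congr 1
  ext f
  exact Equiv.sum_comp e fun a => ((σ a : ℤ) : ℝ) * g f (z a)

theorem bddAbove_signSup (hg : ∀ f z, g f z ∈ Set.Icc 0 M) (σ : κ → ℤˣ) (z : κ → Z) :
    BddAbove (Set.range fun f => ∑ a, ((σ a : ℤ) : ℝ) * g f (z a)) :=
  bddAbove_range_signSum (f := fun a f => g f (z a)) (C := M)
    (fun a f => by rw [abs_of_nonneg (hg _ _).1]; exact (hg _ _).2) σ

theorem abs_signSup_le [Nonempty ι] (hg : ∀ f z, g f z ∈ Set.Icc 0 M) (σ : κ → ℤˣ) (z : κ → Z) :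
    |signSup g σ z| ≤ Fintype.card κ * M := by
  have h : ∀ f, |∑ a, ((σ a : ℤ) : ℝ) * g f (z a)| ≤ Fintype.card κ * M := by
    intro f
    refine (Finset.abs_sum_le_sum_abs _ _).trans ?_
    rw [← nsmul_eq_mul]
    refine Finset.sum_le_card_nsmul _ _ _ fun a _ => ?_
    rw [abs_mul, abs_units_int_cast, one_mul, abs_of_nonneg (hg _ _).1]
    exact (hg _ _).2
  obtain ⟨f⟩ := ‹Nonempty ι›
  rw [abs_le]
  exact ⟨(abs_le.1 (h f)).1.trans (le_ciSup (bddAbove_signSup hg σ z) f),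
    ciSup_le fun f => (abs_le.1 (h f)).2⟩

/-- Two values in `[0, M]` differ by at most `M`, so a single term costs `M` for either sign, not
`2M`. -/
theorem signSup_le_update_add [Nonempty ι] [DecidableEq κ] (hg : ∀ f z, g f z ∈ Set.Icc 0 M)
    (σ : κ → ℤˣ) (z : κ → Z) (i : κ) (x : Z) :
    signSup g σ z ≤ signSup g σ (Function.update z i x) + M := by
  refine ciSup_le fun f => ?_
  have h1 : ∑ a, ((σ a : ℤ) : ℝ) * g f (Function.update z i x a) ≤
      signSup g σ (Function.update z i x) :=
    le_ciSup (bddAbove_signSup hg σ (Function.update z i x)) f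
  rw [← Finset.add_sum_erase _ _ (Finset.mem_univ i)] at h1 ⊢
  have h2 : ∑ a ∈ Finset.univ.erase i, ((σ a : ℤ) : ℝ) * g f (Function.update z i x a) =
      ∑ a ∈ Finset.univ.erase i, ((σ a : ℤ) : ℝ) * g f (z a) :=
    Finset.sum_congr rfl fun a ha => by rw [Function.update_of_ne (Finset.ne_of_mem_erase ha)]
  rw [h2, Function.update_self] at h1
  have h3 := hg f x
  have h4 := hg f (z i)
  rw [Set.mem_Icc] at h3 h4
  have h5 : ((σ i : ℤ) : ℝ) * g f (z i) ≤ ((σ i : ℤ) : ℝ) * g f x + M := by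
    rcases Int.units_eq_one_or (σ i) with h | h <;> rw [h] <;> push_cast <;> linarith
  linarith

theorem signSup_sum_le [Nonempty ι] (hg : ∀ f z, g f z ∈ Set.Icc 0 M) (σ : κ ⊕ κ' → ℤˣ)
    (z : κ ⊕ κ' → Z) :
    signSup g σ z ≤
      signSup g (σ ∘ Sum.inl) (z ∘ Sum.inl) + signSup g (σ ∘ Sum.inr) (z ∘ Sum.inr) := by
  refine ciSup_le fun f => ?_
  rw [Fintype.sum_sum_type]
  exact add_le_add
    (le_ciSup (bddAbove_signSup hg (σ ∘ Sum.inl) (z ∘ Sum.inl)) f)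
    (le_ciSup (bddAbove_signSup hg (σ ∘ Sum.inr) (z ∘ Sum.inr)) f)

theorem signSup_const_sub [Nonempty ι] (hg : ∀ f z, g f z ∈ Set.Icc 0 M) (σ : κ → ℤˣ)
    (z : κ → Z) :
    signSup (fun f z => M - g f z) σ z = ∑ a, ((σ a : ℤ) : ℝ) * M + signSup g (-σ) z := by
  have h : ∀ f, ∑ a, ((σ a : ℤ) : ℝ) * (M - g f (z a)) =
      ∑ a, ((σ a : ℤ) : ℝ) * M + ∑ a, (((-σ) a : ℤ) : ℝ) * g f (z a) := by
    intro f
    rw [← Finset.sum_add_distrib]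
    refine Finset.sum_congr rfl fun a _ => ?_
    rw [Pi.neg_apply, Units.val_neg, Int.cast_neg]
    ring
  simp only [signSup]
  rw [add_ciSup (bddAbove_signSup hg (-σ) z)]
  simp_rw [h]

end SignSup

/-- The permutation exchanging the two copies of the indices where `σ` is negative. -/
def swapNeg {κ : Type*} (σ : κ → ℤˣ) : κ ⊕ κ ≃ κ ⊕ κ :=
  Function.Involutive.toPerm (fun a : κ ⊕ κ => if σ (a.elim id id) = 1 then a else a.swap) (by
    rintro (a | a) <;> by_cases h : σ a = 1 <;> simp [h])

theorem sumElim_one_comp_swapNeg {κ : Type*} (σ : κ → ℤˣ) :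
    (Sum.elim 1 (-1) : κ ⊕ κ → ℤˣ) ∘ swapNeg σ = Sum.elim σ (-σ) := by
  ext a
  rcases a with a | a <;> rcases Int.units_eq_one_or (σ a) with h | h <;>
    
    simp [swapNeg, Function.Involutive.toPerm, h]

section Symmetrization

variable {Z ι κ κ' : Type*} [Fintype κ] [Fintype κ'] [MeasurableSpace Z] {D : Measure Z}
  [IsProbabilityMeasure D] {g : ι → Z → ℝ} {M : ℝ}

theorem measurePreserving_comp_equiv (D : Measure Z) [IsProbabilityMeasure D] (e : κ' ≃ κ) :
    MeasurePreserving (fun z : κ → Z => z ∘ e) (Measure.pi fun _ => D)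
      (Measure.pi fun _ => D) := by
  have h := measurePreserving_piCongrLeft (fun _ : κ' => D) e.symm
  convert h using 1
  ext z a
  have := MeasurableEquiv.piCongrLeft_apply_apply (β := fun _ : κ' => Z) e.symm z (e a)
  simpa using this.symm

theorem aemeasurable_signSup
    (hclass : ∀ (m : ℕ) (σ : Fin m → ℤˣ), AEMeasurable (signSup g σ) (Measure.pi fun _ => D))
    (σ : κ → ℤˣ) : AEMeasurable (signSup g σ) (Measure.pi fun _ => D) := by
  have e := (Fintype.equivFin κ).symm
  have h := (hclass _ (σ ∘ e)).comp_quasiMeasurePreserving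
    (measurePreserving_comp_equiv D e).quasiMeasurePreserving
  refine h.congr (Filter.Eventually.of_forall fun z => ?_)
  exact signSup_comp_equiv e σ z

theorem measurePreserving_sumElim (D : Measure Z) [IsProbabilityMeasure D] :
    MeasurePreserving (fun p : (κ → Z) × (κ' → Z) => (Sum.elim p.1 p.2 : κ ⊕ κ' → Z))
      ((Measure.pi fun _ => D).prod (Measure.pi fun _ => D)) (Measure.pi fun _ => D) := by
  have h := measurePreserving_sumPiEquivProdPi_symm (fun _ : κ ⊕ κ' => D)
  convert h using 1
  ext p a
  rcases a with a | a <;> rfl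

theorem integral_comp_measurePreserving {α β : Type*} [MeasurableSpace α] [MeasurableSpace β]
    {μ : Measure α} {ν : Measure β} {φ : α → β} (hφ : MeasurePreserving φ μ ν) {f : β → ℝ}
    (hf : AEMeasurable f ν) : ∫ x, f (φ x) ∂μ = ∫ y, f y ∂ν := by
  conv_rhs => rw [← hφ.map_eq]
  rw [integral_map hφ.aemeasurable (by rw [hφ.map_eq]; exact hf.aestronglyMeasurable)]

theorem integral_signSup_sumElim_le [DecidableEq κ] [Nonempty ι] (hg : ∀ f z, g f z ∈ Set.Icc 0 M)
    (hclass : ∀ (m : ℕ) (σ : Fin m → ℤˣ), AEMeasurable (signSup g σ) (Measure.pi fun _ => D)) :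
    ∫ z, signSup g (Sum.elim 1 (-1) : κ ⊕ κ → ℤˣ) z ∂(Measure.pi fun _ => D) ≤
      2 * 𝔼 σ : κ → ℤˣ, ∫ z, signSup g σ z ∂(Measure.pi fun _ => D) := by
  have hint : ∀ {κ : Type _} [Fintype κ] (σ : κ → ℤˣ),
      Integrable (signSup g σ) (Measure.pi fun _ => D) := fun {κ} _ σ =>
    integrable_of_abs_le (aemeasurable_signSup hclass σ) (abs_signSup_le hg σ)
  have hstep : ∀ σ : κ → ℤˣ,
      ∫ z, signSup g (Sum.elim 1 (-1) : κ ⊕ κ → ℤˣ) z ∂(Measure.pi fun _ => D) ≤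
        ∫ z, signSup g σ z ∂(Measure.pi fun _ => D) +
          ∫ z, signSup g (-σ) z ∂(Measure.pi fun _ => D) := by
    intro σ
    -- Exchanging `z_a` with its ghost copy wherever `σ a = -1` preserves the i.i.d. law and turns
    -- the signs `(1, -1)` into `(σ, -σ)`.
    have hswap : ∫ z, signSup g (Sum.elim 1 (-1) : κ ⊕ κ → ℤˣ) z ∂(Measure.pi fun _ => D) =
        ∫ z, signSup g (Sum.elim σ (-σ)) z ∂(Measure.pi fun _ => D) := by
      rw [← integral_comp_measurePreserving (measurePreserving_comp_equiv D (swapNeg σ))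
        (aemeasurable_signSup hclass (Sum.elim σ (-σ))), ← sumElim_one_comp_swapNeg σ]
      exact integral_congr_ae (Filter.Eventually.of_forall fun z =>
        (signSup_comp_equiv (swapNeg σ) _ z).symm)
    rw [hswap, ← integral_comp_measurePreserving (measurePreserving_sumElim (κ := κ) (κ' := κ) D)
      (aemeasurable_signSup hclass _)]
    have h1 := (measurePreserving_fst (μ := Measure.pi fun _ : κ => D)
      (ν := Measure.pi fun _ : κ => D))
    have h2 := (measurePreserving_snd (μ := Measure.pi fun _ : κ => D)
      (ν := Measure.pi fun _ : κ => D))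
    have i1 : Integrable (fun p : (κ → Z) × (κ → Z) => signSup g σ p.1)
        ((Measure.pi fun _ => D).prod (Measure.pi fun _ => D)) :=
      h1.integrable_comp_of_integrable (hint σ)
    have i2 : Integrable (fun p : (κ → Z) × (κ → Z) => signSup g (-σ) p.2)
        ((Measure.pi fun _ => D).prod (Measure.pi fun _ => D)) :=
      h2.integrable_comp_of_integrable (hint (-σ))
    rw [← integral_comp_measurePreserving h1 (aemeasurable_signSup hclass σ),
      ← integral_comp_measurePreserving h2 (aemeasurable_signSup hclass (-σ)),
      ← integral_add i1 i2]
    refine integral_mono ((measurePreserving_sumElim D).integrable_comp_of_integrable (hint _))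
      (i1.add i2) fun p => ?_
    exact signSup_sum_le hg (Sum.elim σ (-σ)) (Sum.elim p.1 p.2)
  -- The left side does not depend on `σ`, and `-σ` is distributed like `σ`.
  have havg := Finset.expect_le_expect (s := Finset.univ) fun σ (_ : σ ∈ Finset.univ) => hstep σ
  rw [Fintype.expect_const, Finset.expect_add_distrib,
    Fintype.expect_equiv (Equiv.neg (κ → ℤˣ))
      (fun σ => ∫ z, signSup g (-σ) z ∂(Measure.pi fun _ => D))
      (fun σ => ∫ z, signSup g σ z ∂(Measure.pi fun _ => D)) fun _ => rfl] at havg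
  linarith

end Symmetrization

/-! ### Uniform deviation bounds. -/

section UniformDeviation

variable {Z ι : Type*} [MeasurableSpace Z] {D : Measure Z}
  [IsProbabilityMeasure D] {g : ι → Z → ℝ} {M : ℝ≥0} {N : ℕ}

/-- A one-sided uniform deviation bound in terms of the empirical Rademacher complexity. -/
theorem measureReal_deviation_le [Nonempty ι] (hg : ∀ f z, g f z ∈ Set.Icc 0 (M : ℝ))
    (hmeas : ∀ f, AEMeasurable (g f) D)
    (hclass : ∀ (m : ℕ) (σ : Fin m → ℤˣ), AEMeasurable (signSup g σ) (Measure.pi fun _ => D))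
    {ε : ℝ} (hε : 0 ≤ ε) :
    (Measure.pi fun _ : Fin N => D).real {z | ¬ ∀ f,
        N * ∫ x, g f x ∂D - ∑ i, g f (z i) ≤ 2 * 𝔼 σ : Fin N → ℤˣ, signSup g σ z + ε} ≤
      Real.exp (-(2 * ε ^ 2 / (9 * N * M ^ 2))) := by
  set P : Measure (Fin N → Z) := Measure.pi fun _ => D with hP
  set s : Fin N ⊕ Fin N → ℤˣ := Sum.elim 1 (-1) with hs
  set C : ℝ := Fintype.card (Fin N ⊕ Fin N) * M with hCdef
  have hC : ∀ z, |signSup g s z| ≤ C := abs_signSup_le hg s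
  have hmp : MeasurePreserving (fun p : (Fin N → Z) × (Fin N → Z) =>
      (Sum.elim p.2 p.1 : Fin N ⊕ Fin N → Z)) (P.prod P) (Measure.pi fun _ => D) :=
    (measurePreserving_sumElim D).comp Measure.measurePreserving_swap
  have hjoint : AEMeasurable (fun p : (Fin N → Z) × (Fin N → Z) =>
      signSup g s (Sum.elim p.2 p.1)) (P.prod P) :=
    (aemeasurable_signSup hclass s).comp_quasiMeasurePreserving hmp.quasiMeasurePreserving
  -- The supremum of the centred deviations is not assumed measurable. `Ψ` dominates it and inherits
  -- measurability from a signed supremum over `2N` points.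
  set Ψ : (Fin N → Z) → ℝ := fun z => lowerMean P C fun w => signSup g s (Sum.elim w z)
    with hΨ
  set R : (Fin N → Z) → ℝ := fun z => 𝔼 σ : Fin N → ℤˣ, signSup g σ z with hR
  have hΨm : AEMeasurable Ψ P := aemeasurable_lowerMean
    (f := fun p : (Fin N → Z) × (Fin N → Z) => signSup g s (Sum.elim p.2 p.1)) hjoint
  have hΨC : ∀ z, |Ψ z| ≤ C := fun z => abs_lowerMean_le fun w => hC _
  have hΨE : ∫ z, Ψ z ∂P = ∫ z, signSup g s z ∂(Measure.pi fun _ => D) := by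
    rw [← integral_comp_measurePreserving hmp (aemeasurable_signSup hclass s)]
    exact integral_lowerMean
      (f := fun p : (Fin N → Z) × (Fin N → Z) => signSup g s (Sum.elim p.2 p.1)) hjoint
      fun p => hC _
  have hΨc : ∀ z i x, Ψ z ≤ Ψ (Function.update z i x) + M := by
    intro z i x
    refine lowerMean_le_add M.2 (fun w => (abs_le.1 (hC _)).2) fun w => ?_
    have := signSup_le_update_add hg s (Sum.elim w z) (Sum.inr i) x
    rwa [Sum.update_elim_inr] at this
  have hsm : ∀ σ : Fin N → ℤˣ, AEMeasurable (signSup g σ) P := aemeasurable_signSup hclass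
  have hRm : AEMeasurable R P := by
    simp only [hR, Fintype.expect_eq_sum_div_card]
    exact (Finset.aemeasurable_fun_sum _ fun σ _ => hsm σ).div_const _
  have hRC : ∀ z, |R z| ≤ N * M := by
    intro z
    refine (Finset.abs_expect_le _ _).trans ?_
    rw [← Fintype.expect_const (ι := Fin N → ℤˣ) ((N : ℝ) * M)]
    refine Finset.expect_le_expect fun σ _ => ?_
    simpa using abs_signSup_le hg σ z
  have hRE : ∫ z, R z ∂P = 𝔼 σ : Fin N → ℤˣ, ∫ z, signSup g σ z ∂P := by
    simp only [hR, Fintype.expect_eq_sum_div_card]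
    rw [integral_div, integral_finsetSum]
    exact fun σ _ => integrable_of_abs_le (hsm σ) (abs_signSup_le hg σ)
  have hRc : ∀ z i x, R (Function.update z i x) ≤ R z + M := by
    intro z i x
    have h : ∀ σ : Fin N → ℤˣ, signSup g σ (Function.update z i x) ≤ signSup g σ z + M := by
      intro σ
      simpa using signSup_le_update_add hg σ (Function.update z i x) i (z i)
    refine (Finset.expect_le_expect fun σ _ => h σ).trans_eq ?_
    rw [Finset.expect_add_distrib, Fintype.expect_const]
  have hE : ∫ z, (Ψ z - 2 * R z) ∂P ≤ 0 := by
    rw [integral_sub (integrable_of_abs_le hΨm hΨC)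
      ((integrable_of_abs_le hRm hRC).const_mul 2), integral_const_mul, hΨE, hRE]
    exact sub_nonpos.2 (integral_signSup_sumElim_le (κ := Fin N) hg hclass)
  -- One point changes `Ψ` by `M` and `2R` by `2M`, hence `3 * M`. Treating both together avoids a
  -- separate tail estimate for `R`.
  have hsub := hasSubgaussianMGF_of_bounded_differences (D := D) (F := fun z => Ψ z - 2 * R z)
    (C := C + 2 * (N * M)) (c := 3 * M) (hΨm.sub (hRm.const_mul 2))
    (fun z => by
      refine (abs_sub _ _).trans (add_le_add (hΨC z) ?_)
      rw [abs_mul, abs_two]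
      exact mul_le_mul_of_nonneg_left (hRC z) zero_le_two)
    (fun z i x => by
      have h1 := hΨc z i x
      have h2 := hRc z i x
      push_cast
      linarith)
  have hmain := hsub.measure_ge_le hε
  refine (measureReal_mono ?_).trans (hmain.trans (le_of_eq ?_))
  · intro z hz
    simp only [Set.mem_ofPred_eq, not_forall, not_le] at hz ⊢
    obtain ⟨f, hf⟩ := hz
    have hle : N * ∫ x, g f x ∂D - ∑ i, g f (z i) ≤ Ψ z := by
      have hgi : ∀ i : Fin N, Integrable (fun w : Fin N → Z => g f (w i)) P := fun i =>
        (measurePreserving_eval (fun _ : Fin N => D) i).integrable_comp_of_integrable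
          (integrable_of_abs_le (hmeas f) fun x => by
            rw [abs_of_nonneg (hg _ _).1]; exact (hg _ _).2)
      have heq : N * ∫ x, g f x ∂D - ∑ i, g f (z i) =
          ∫ w : Fin N → Z, (∑ i, g f (w i) - ∑ i, g f (z i)) ∂P := by
        rw [integral_sub (integrable_finsetSum _ fun i _ => hgi i) (integrable_const _),
          integral_finsetSum _ fun i _ => hgi i]
        have hi : ∀ i : Fin N, ∫ w : Fin N → Z, g f (w i) ∂P = ∫ x, g f x ∂D := fun i =>
          integral_comp_eval (μ := fun _ : Fin N => D) (hmeas f).aestronglyMeasurable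
        simp [hi]
      have hval : ∀ w : Fin N → Z, ∑ i, g f (w i) - ∑ i, g f (z i) =
          ∑ a, ((s a : ℤ) : ℝ) * g f ((Sum.elim w z : Fin N ⊕ Fin N → Z) a) := by
        intro w
        simp [hs, Fintype.sum_sum_type, sub_eq_add_neg]
      rw [heq]
      refine integral_le_lowerMean
        ((integrable_finsetSum _ fun i _ => hgi i).sub (integrable_const _)).aemeasurable
        (fun w => ?_) (fun w => (abs_le.1 (hC _)).2) fun w => ?_
      · rw [hval]
        have := abs_signSup_le (ι := Unit) (g := fun _ => g f) (fun _ => hg f) s (Sum.elim w z)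
        simpa only [signSup, ciSup_unique] using this
      · rw [hval]
        exact le_ciSup (bddAbove_signSup hg s (Sum.elim w z)) f
    linarith
  · congr 1
    push_cast
    rw [neg_div]
    congr 1
    -- If `N * M ^ 2 = 0`, both exponents are divisions by zero, hence both are `0`.
    by_cases h : (N : ℝ) * M ^ 2 = 0
    · rw [show 2 * ((N : ℝ) * (3 * M / 2) ^ 2) = (9 / 2) * (N * M ^ 2) by ring, mul_assoc, h]
      simp
    · have h1 : (N : ℝ) ≠ 0 := left_ne_zero_of_mul h
      have h2 : (M : ℝ) ≠ 0 := fun h0 => h (by rw [h0]; ring)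
      field_simp
      ring

theorem expect_sum_signs_mul (N : ℕ) (M : ℝ) :
    𝔼 σ : Fin N → ℤˣ, ∑ a, ((σ a : ℤ) : ℝ) * M = 0 := by
  have h := expect_neg_arg fun σ : Fin N → ℤˣ => ∑ a, ((σ a : ℤ) : ℝ) * M
  simp only [Pi.neg_apply, Units.val_neg, Int.cast_neg, neg_mul, Finset.sum_neg_distrib,
    Finset.expect_neg_distrib] at h
  linarith

/-- The lower counterpart of `measureReal_deviation_le`. -/
theorem measureReal_deviation_ge [Nonempty ι] (hg : ∀ f z, g f z ∈ Set.Icc 0 (M : ℝ))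
    (hmeas : ∀ f, AEMeasurable (g f) D)
    (hclass : ∀ (m : ℕ) (σ : Fin m → ℤˣ), AEMeasurable (signSup g σ) (Measure.pi fun _ => D))
    {ε : ℝ} (hε : 0 ≤ ε) :
    (Measure.pi fun _ : Fin N => D).real {z | ¬ ∀ f,
        ∑ i, g f (z i) - N * ∫ x, g f x ∂D ≤ 2 * 𝔼 σ : Fin N → ℤˣ, signSup g σ z + ε} ≤
      Real.exp (-(2 * ε ^ 2 / (9 * N * M ^ 2))) := by
  -- Reflection preserves `[0, M]` and reverses the deviations. Averaged over signs, the constants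
  -- `M` cancel and the complexity is unchanged.
  have h := measureReal_deviation_le (D := D) (g := fun f z => M - g f z) (M := M) (N := N)
    (fun f z => ⟨sub_nonneg.2 (hg f z).2, sub_le_self _ (hg f z).1⟩)
    (fun f => (hmeas f).const_sub _)
    (fun m σ => by
      have e : signSup (fun f z => (M : ℝ) - g f z) σ =
          fun z => ∑ a, ((σ a : ℤ) : ℝ) * M + signSup g (-σ) z :=
        funext fun z => signSup_const_sub hg σ z
      rw [e]
      exact (hclass m (-σ)).const_add _) hε
  convert h using 4 with z
  refine not_congr (forall_congr' fun f => ?_)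
  have h1 : ∫ x, ((M : ℝ) - g f x) ∂D = M - ∫ x, g f x ∂D := by
    rw [integral_sub (integrable_const _) (integrable_of_abs_le (hmeas f) fun x => by
      rw [abs_of_nonneg (hg _ _).1]; exact (hg _ _).2)]
    simp
  have h2 : 𝔼 σ : Fin N → ℤˣ, signSup (fun f z => (M : ℝ) - g f z) σ z =
      𝔼 σ : Fin N → ℤˣ, signSup g σ z := by
    simp_rw [signSup_const_sub hg]
    rw [Finset.expect_add_distrib, expect_sum_signs_mul, zero_add,
      expect_neg_arg fun σ => signSup g σ z]
  rw [h1, h2, Finset.sum_sub_distrib]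
  simp only [Finset.sum_const, Finset.card_univ, Fintype.card_fin, nsmul_eq_mul]
  constructor <;> intro h <;> linarith

end UniformDeviation

/-! ### Clipped predictors, trajectories and events of high probability. -/

section Clip

variable {E : Type*} [NormedAddCommGroup E] [NormedSpace ℝ E]

theorem norm_clip_le {B : ℝ} (hB : 0 < B) (f : E → E) (x : E) : ‖clip B f x‖ ≤ B := by
  unfold clip
  split_ifs with h
  · have hpos : 0 < ‖f x‖ := hB.trans h
    rw [norm_smul, Real.norm_of_nonneg (by positivity), div_mul_cancel₀ _ hpos.ne']
  · exact not_lt.1 h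

theorem measurable_clip [MeasurableSpace E] [BorelSpace E] [SecondCountableTopology E]
    (B : ℝ) {f : E → E} (hf : Measurable f) : Measurable (clip B f) := by
  unfold clip
  exact Measurable.ite (measurableSet_lt measurable_const hf.norm)
    ((measurable_const.div hf.norm).smul hf) hf

end Clip

theorem measurable_trajectory {E : Type*} [MeasurableSpace E] {fstar : E → E}
    (h : Measurable fstar) (t : ℕ) :
    Measurable fun ξ => trajectory fstar ξ t :=
  h.iterate t

theorem measurable_trajLoss {E : Type*} [NormedAddCommGroup E] [MeasurableSpace E]
    [BorelSpace E] [SecondCountableTopology E]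
    {ℓ : E → ℝ} (hℓ : Continuous ℓ) {fstar f : E → E} (hfstar : Measurable fstar)
    (hf : Measurable f) (T : ℕ) :
    Measurable fun ξ => trajLoss ℓ T f (trajectory fstar ξ) := by
  unfold trajLoss
  refine measurable_const.mul (Finset.measurable_fun_sum _ fun t _ => hℓ.measurable.comp ?_)
  exact (hf.comp (measurable_trajectory hfstar t)).sub (measurable_trajectory hfstar (t + 1))

theorem hasProbAtLeast_of_compl_le {Ω : Type*} [MeasurableSpace Ω] {P : Measure Ω}
    [IsProbabilityMeasure P] {A : Set Ω} {δ : ℝ} (h : P.real Aᶜ ≤ δ) :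
    HasProbAtLeast P (1 - δ) A := by
  refine ⟨(toMeasurable P Aᶜ)ᶜ, (measurableSet_toMeasurable _ _).compl,
    Set.compl_subset_comm.1 (subset_toMeasurable _ _), ?_⟩
  rw [prob_compl_eq_one_sub (measurableSet_toMeasurable _ _), measure_toMeasurable]
  refine (ENNReal.ofReal_le_ofReal (sub_le_sub_left h 1)).trans ?_
  rw [ENNReal.ofReal_sub _ measureReal_nonneg, ENNReal.ofReal_one, ofReal_measureReal]

/-! ### From the loss class to the penalty. -/

section Penalty

variable {n N T : ℕ} {ℓ : EuclideanSpace ℝ (Fin n) → ℝ} {B : ℝ} {L : ℝ≥0}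
  {Fk : Set (EuclideanSpace ℝ (Fin n) → EuclideanSpace ℝ (Fin n))}

theorem empRademacher_componentClass
    (j : Fin n) (z : Fin N → EuclideanSpace ℝ (Fin n)) :
    empRademacher (componentClass B Fk j) z =
      (1 / (N : ℝ)) * 𝔼 σ : Fin N → ℤˣ, ⨆ f : Fk, ∑ i, ((σ i : ℤ) : ℝ) * clip B f.1 (z i) j := by
  let φ : Fk → componentClass B Fk j := fun f => ⟨fun x => clip B f.1 x j, f.1, f.2, rfl⟩
  have hφ : Function.Surjective φ := by
    rintro ⟨g, f, hf, rfl⟩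
    exact ⟨⟨f, hf⟩, rfl⟩
  rw [empRademacher, Finset.mul_expect, Fintype.expect_eq_sum_div_card, one_div_mul_eq_div]
  congr 1
  · refine Finset.sum_congr rfl fun σ _ => ?_
    rw [← Real.mul_iSup_of_nonneg (by positivity), ← hφ.iSup_comp]
  · simp

theorem sub_mem_closedBall_two_mul {E : Type*} [NormedAddCommGroup E] {B : ℝ} {v w : E}
    (hv : ‖v‖ ≤ B) (hw : ‖w‖ ≤ B) : v - w ∈ Metric.closedBall (0 : E) (2 * B) := by
  rw [mem_closedBall_zero_iff]
  exact (norm_sub_le _ _).trans (by linarith)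

theorem loss_mem_Icc {E : Type*} [NormedAddCommGroup E] {ℓ : E → ℝ} (hℓ : ∀ x, 0 ≤ ℓ x)
    (hℓ0 : ℓ 0 = 0) {B : ℝ} (hB : 0 < B)
    (hL : LipschitzOnWith L ℓ (Metric.closedBall 0 (2 * B))) {v w : E}
    (hv : ‖v‖ ≤ B) (hw : ‖w‖ ≤ B) : ℓ (v - w) ∈ Set.Icc 0 (2 * L * B) := by
  have hmem := sub_mem_closedBall_two_mul hv hw
  have h := hL.dist_le_mul (v - w) hmem 0 (by simp [hB.le])
  rw [hℓ0, Real.dist_eq, sub_zero, abs_of_nonneg (hℓ _), dist_zero_right] at h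
  rw [mem_closedBall_zero_iff] at hmem
  refine ⟨hℓ _, h.trans ?_⟩
  nlinarith [L.2, mul_le_mul_of_nonneg_left hmem L.2]

/-- The Rademacher complexity of the loss class is controlled by the penalty. -/
theorem expect_signSum_trajLoss_le_penalty [Nonempty Fk] (hN : 1 ≤ N)
    (hℓ : ∀ x, 0 ≤ ℓ x) (hℓ0 : ℓ 0 = 0) (hB : 0 < B)
    (hL : LipschitzOnWith L ℓ (Metric.closedBall 0 (2 * B)))
    (S : Fin N → ℕ → EuclideanSpace ℝ (Fin n)) (hS : ∀ i, ∀ t ≤ T, ‖S i t‖ ≤ B) :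
    2 * 𝔼 σ : Fin N → ℤˣ, ⨆ f : Fk, ∑ i, ((σ i : ℤ) : ℝ) * trajLoss ℓ T (clip B f.1) (S i) ≤
      N * penalty L B T Fk S := by
  have hN0 : (N : ℝ) ≠ 0 := by positivity
  set u : ℕ → Fin N → Fk → ℝ := fun t i f => ℓ (clip B f.1 (S i t) - S i (t + 1)) with hu
  have hLB : (0 : ℝ) ≤ 2 * L * B := by positivity
  -- One constant has to serve for the contraction lemma: losses are at most `2LB` and components at
  -- most `B`.
  have hub : ∀ t < T, ∀ i f, |u t i f| ≤ 2 * L * B + B := by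
    intro t ht i f
    have := loss_mem_Icc hℓ hℓ0 hB hL (norm_clip_le hB f.1 (S i t)) (hS i (t + 1) ht)
    rw [abs_of_nonneg this.1]
    linarith [this.2]
  have hsup : ∀ σ : Fin N → ℤˣ,
      ⨆ f : Fk, ∑ i, ((σ i : ℤ) : ℝ) * trajLoss ℓ T (clip B f.1) (S i) ≤
        (1 / (T : ℝ)) * ∑ t ∈ Finset.range T, ⨆ f : Fk, ∑ i, ((σ i : ℤ) : ℝ) * u t i f := by
    intro σ
    refine ciSup_le fun f => ?_
    have h : ∑ i, ((σ i : ℤ) : ℝ) * trajLoss ℓ T (clip B f.1) (S i) =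
        (1 / (T : ℝ)) * ∑ t ∈ Finset.range T, ∑ i, ((σ i : ℤ) : ℝ) * u t i f := by
      rw [Finset.sum_comm, Finset.mul_sum]
      refine Finset.sum_congr rfl fun i _ => ?_
      rw [trajLoss, ← Finset.mul_sum]
      ring
    rw [h]
    refine mul_le_mul_of_nonneg_left (Finset.sum_le_sum fun t ht => ?_) (by positivity)
    exact le_ciSup (bddAbove_range_signSum (hub t (Finset.mem_range.1 ht)) σ) f
  have hcontr : ∀ t ∈ Finset.range T,
      𝔼 σ : Fin N → ℤˣ, ⨆ f : Fk, ∑ i, ((σ i : ℤ) : ℝ) * u t i f ≤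
        √2 * L * ∑ j, N * empRademacher (componentClass B Fk j) fun i => S i t := by
    intro t ht
    rw [Finset.mem_range] at ht
    refine (expect_signSum_iSup_le_sum (v := fun i j (f : Fk) => clip B f.1 (S i t) j)
      (hub t ht) ?_ L.coe_nonneg ?_).trans_eq ?_
    · intro i j f
      have h1 := PiLp.norm_apply_le (clip B f.1 (S i t)) j
      rw [Real.norm_eq_abs] at h1
      linarith [norm_clip_le hB f.1 (S i t)]
    · intro i f g
      have h := hL.dist_le_mul _
        (sub_mem_closedBall_two_mul (norm_clip_le hB f.1 (S i t)) (hS i (t + 1) ht)) _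
        (sub_mem_closedBall_two_mul (norm_clip_le hB g.1 (S i t)) (hS i (t + 1) ht))
      rw [dist_sub_right, Real.dist_eq, EuclideanSpace.dist_eq] at h
      simpa only [hu, Real.dist_eq, sq_abs] using h
    · congr 1
      refine Finset.sum_congr rfl fun j _ => ?_
      rw [empRademacher_componentClass, ← mul_assoc, mul_one_div_cancel hN0, one_mul]
  calc 2 * 𝔼 σ : Fin N → ℤˣ,
        ⨆ f : Fk, ∑ i, ((σ i : ℤ) : ℝ) * trajLoss ℓ T (clip B f.1) (S i)
      ≤ 2 * ((1 / (T : ℝ)) * ∑ t ∈ Finset.range T,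
          𝔼 σ : Fin N → ℤˣ, ⨆ f : Fk, ∑ i, ((σ i : ℤ) : ℝ) * u t i f) := by
        rw [← Finset.expect_sum_comm, Finset.mul_expect _ _ (1 / (T : ℝ))]
        exact mul_le_mul_of_nonneg_left (Finset.expect_le_expect fun σ _ => hsup σ) zero_le_two
    _ ≤ 2 * ((1 / (T : ℝ)) * ∑ t ∈ Finset.range T,
          √2 * L * ∑ j, N * empRademacher (componentClass B Fk j) fun i => S i t) := by
        gcongr with t ht
        exact hcontr t ht
    _ = N * penalty L B T Fk S := by
        simp_rw [penalty, ← Finset.mul_sum]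
        ring

end Penalty

/-! ### Deviation bound for one class. -/

section ErrorBound

variable {n N T : ℕ} {D : Measure (EuclideanSpace ℝ (Fin n))} [IsProbabilityMeasure D]
  {fstar : EuclideanSpace ℝ (Fin n) → EuclideanSpace ℝ (Fin n)}
  {ℓ : EuclideanSpace ℝ (Fin n) → ℝ} {B : ℝ} {L : ℝ≥0}
  {Fk : Set (EuclideanSpace ℝ (Fin n) → EuclideanSpace ℝ (Fin n))}

/-- The uniform deviation bound for a single class of predictors. -/
theorem measureReal_errorBound_lt_le (hN : 1 ≤ N) (hfstar : Measurable fstar)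
    (hℓ : ∀ x, 0 ≤ ℓ x) (hℓ_cont : Continuous ℓ) (hℓ0 : ℓ 0 = 0) (hB : 0 < B)
    (hbound : ∀ᵐ ξ ∂D, ∀ t ≤ T, ‖trajectory fstar ξ t‖ ≤ B) (hL : 0 < L)
    (hL_lip : LipschitzOnWith L ℓ (Metric.closedBall 0 (2 * B)))
    (hF_meas : ∀ f ∈ Fk, Measurable f)
    (hF_class : IsMeasurableClass D (lossClass ℓ fstar B T Fk))
    {δ : ℝ} (hδ : 0 < δ) (hδ4 : δ ≤ 4) :
    (Measure.pi fun _ : Fin N => D).real {S0 | ¬ ∀ f ∈ Fk,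
      |trueError ℓ fstar T D (clip B f) - trainError ℓ T (dataset fstar S0) (clip B f)| ≤
        errorBound L B T Fk (dataset fstar S0) δ} ≤ δ / 2 := by
  rcases Fk.eq_empty_or_nonempty with rfl | hne
  · simp [show 0 ≤ δ / 2 by positivity]
  have : Nonempty Fk := hne.to_subtype
  set P : Measure (Fin N → EuclideanSpace ℝ (Fin n)) := Measure.pi fun _ => D with hP
  have hN0 : (0 : ℝ) < N := by exact_mod_cast hN
  set A : Set (EuclideanSpace ℝ (Fin n)) := {ξ | ∀ t ≤ T, ‖trajectory fstar ξ t‖ ≤ B} with hA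
  have hAm : MeasurableSet A := by
    have : A = ⋂ t ≤ T, {ξ | ‖trajectory fstar ξ t‖ ≤ B} := by ext; simp [hA]
    rw [this]
    exact MeasurableSet.iInter fun t => MeasurableSet.iInter fun _ =>
      measurableSet_le (measurable_trajectory hfstar t).norm measurable_const
  have hA_ae : ∀ (m : ℕ), ∀ᵐ z ∂(Measure.pi fun _ : Fin m => D), ∀ i, z i ∈ A := by
    intro m
    rw [ae_all_iff]
    exact fun i => (measurePreserving_eval (fun _ : Fin m => D) i).quasiMeasurePreserving.ae hbound
  set φ : Fk → EuclideanSpace ℝ (Fin n) → ℝ :=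
    fun f ξ => trajLoss ℓ T (clip B f.1) (trajectory fstar ξ) with hφ
  -- Cutting off on the null set of unbounded trajectories makes `0 ≤ g ≤ M` hold everywhere, as
  -- bounded differences require, without altering integrals or, almost surely, suprema.
  set g : Fk → EuclideanSpace ℝ (Fin n) → ℝ := fun f => A.indicator (φ f) with hg
  have hgφ : ∀ f, ∀ ξ ∈ A, g f ξ = φ f ξ := fun f ξ hξ => Set.indicator_of_mem hξ _
  set M : ℝ≥0 := 2 * L * B.toNNReal with hM
  have hMB : (M : ℝ) = 2 * L * B := by
    rw [hM]
    push_cast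
    rw [Real.coe_toNNReal _ hB.le]
  have hg01 : ∀ f z, g f z ∈ Set.Icc 0 (M : ℝ) := by
    intro f z
    by_cases hz : z ∈ A
    · have h : ∀ t ∈ Finset.range T, ℓ (clip B f.1 (trajectory fstar z t) -
          trajectory fstar z (t + 1)) ∈ Set.Icc 0 (2 * L * B) := fun t ht =>
        loss_mem_Icc hℓ hℓ0 hB hL_lip (norm_clip_le hB _ _) (hz _ (Finset.mem_range.1 ht))
      have hsum := Finset.sum_le_card_nsmul _ _ _ fun t ht => (h t ht).2
      rw [Finset.card_range, nsmul_eq_mul] at hsum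
      rw [hgφ f z hz, hMB]
      simp only [hφ, trajLoss]
      refine ⟨mul_nonneg (by positivity) (Finset.sum_nonneg fun t ht => (h t ht).1), ?_⟩
      rw [one_div_mul_eq_div]
      exact div_le_of_le_mul₀ (by positivity) (by positivity) (hsum.trans_eq (mul_comm _ _))
    · rw [hg]
      simp [Set.indicator_of_notMem hz]
  have hgm : ∀ f, AEMeasurable (g f) D := fun f =>
    ((measurable_trajLoss hℓ_cont hfstar (measurable_clip B (hF_meas f.1 f.2)) T).indicator
      hAm).aemeasurable
  have hsup : ∀ (m : ℕ) (σ : Fin m → ℤˣ) (z : Fin m → EuclideanSpace ℝ (Fin n)),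
      (∀ i, z i ∈ A) → signSup g σ z = ⨆ f, ∑ i, ((σ i : ℤ) : ℝ) * φ f (z i) := by
    intro m σ z hz
    simp only [signSup]
    congr 1
    ext f
    exact Finset.sum_congr rfl fun i _ => by rw [hgφ f _ (hz i)]
  have hclass : ∀ (m : ℕ) (σ : Fin m → ℤˣ),
      AEMeasurable (signSup g σ) (Measure.pi fun _ => D) := by
    intro m σ
    refine (hF_class m σ).congr ?_
    filter_upwards [hA_ae m] with z hz
    rw [hsup m σ z hz]
    let ψ : Fk → lossClass ℓ fstar B T Fk := fun f => ⟨φ f, f.1, f.2, rfl⟩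
    have hψ : Function.Surjective ψ := by
      rintro ⟨g, f, hf, rfl⟩
      exact ⟨⟨f, hf⟩, rfl⟩
    rw [← hψ.iSup_comp]
  set r : ℝ := Real.sqrt (Real.log (4 / δ) / (2 * (N : ℝ))) with hr
  set ε : ℝ := N * (6 * L * B * r) with hε
  have hlog : 0 ≤ Real.log (4 / δ) := Real.log_nonneg ((one_le_div hδ).2 hδ4)
  have hε0 : 0 ≤ ε := by positivity
  -- The constant `6LB` is `3M`, which cancels the `9 * M ^ 2`. Each side fails with probability at
  -- most `δ / 4`, so together at most `δ / 2`.
  have hexp : Real.exp (-(2 * ε ^ 2 / (9 * N * M ^ 2))) = δ / 4 := by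
    have hr2 : r ^ 2 = Real.log (4 / δ) / (2 * (N : ℝ)) := Real.sq_sqrt (by positivity)
    have hL0 : (0 : ℝ) < L := hL
    have : 2 * ε ^ 2 / (9 * N * M ^ 2) = Real.log (4 / δ) := by
      rw [hε, hMB, mul_pow, mul_pow _ r, hr2]
      field_simp
      ring
    rw [this, Real.exp_neg, Real.exp_log (by positivity), inv_div]
  have hup := measureReal_deviation_le (N := N) hg01 hgm hclass hε0
  have hlo := measureReal_deviation_ge (N := N) hg01 hgm hclass hε0
  rw [hexp] at hup hlo
  have hbad : P.real {z | ¬ ∀ i, z i ∈ A} = 0 := by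
    rw [measureReal_eq_zero_iff]
    exact ae_iff.1 (hA_ae N)
  refine (measureReal_mono (s₂ := {z | ¬ ∀ i, z i ∈ A} ∪ ({z | ¬ ∀ f,
      N * ∫ x, g f x ∂D - ∑ i, g f (z i) ≤ 2 * 𝔼 σ : Fin N → ℤˣ, signSup g σ z + ε} ∪
      {z | ¬ ∀ f, ∑ i, g f (z i) - N * ∫ x, g f x ∂D ≤
        2 * 𝔼 σ : Fin N → ℤˣ, signSup g σ z + ε})) ?_).trans
    ((measureReal_union_le _ _).trans ?_)
  · intro z hz
    by_contra hcon
    simp only [Set.mem_union, Set.mem_ofPred_eq, not_or, not_not] at hcon hz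
    obtain ⟨hzA, hzup, hzlo⟩ := hcon
    refine hz fun f hf => ?_
    have h1 := hzup ⟨f, hf⟩
    have h2 := hzlo ⟨f, hf⟩
    have htrue : ∫ x, g ⟨f, hf⟩ x ∂D = trueError ℓ fstar T D (clip B f) := by
      refine integral_congr_ae ?_
      filter_upwards [hbound] with ξ hξ
      exact hgφ _ ξ hξ
    have htrain : ∑ i, g ⟨f, hf⟩ (z i) =
        N * trainError ℓ T (dataset fstar z) (clip B f) := by
      rw [trainError, Finset.mul_sum, Finset.mul_sum]
      refine Finset.sum_congr rfl fun i _ => ?_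
      rw [hgφ _ _ (hzA i)]
      simp only [hφ, trajLoss, dataset]
      field_simp
    have hpen : 2 * 𝔼 σ : Fin N → ℤˣ, signSup g σ z ≤ N * penalty L B T Fk (dataset fstar z) := by
      simp_rw [hsup N _ z hzA]
      exact expect_signSum_trajLoss_le_penalty hN hℓ hℓ0 hB hL_lip (dataset fstar z) hzA
    rw [htrue, htrain] at h1 h2
    have hsplit : N * errorBound L B T Fk (dataset fstar z) δ =
        N * penalty L B T Fk (dataset fstar z) + ε := by
      rw [errorBound, mul_add]
    rw [abs_le]
    constructor
    · refine le_of_mul_le_mul_left (a := (N : ℝ)) ?_ hN0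
      linarith
    · refine le_of_mul_le_mul_left (a := (N : ℝ)) ?_ hN0
      linarith
  · have := measureReal_union_le (μ := P) {z | ¬ ∀ f,
      N * ∫ x, g f x ∂D - ∑ i, g f (z i) ≤ 2 * 𝔼 σ : Fin N → ℤˣ, signSup g σ z + ε}
      {z | ¬ ∀ f, ∑ i, g f (z i) - N * ∫ x, g f x ∂D ≤
        2 * 𝔼 σ : Fin N → ℤˣ, signSup g σ z + ε}
    linarith

end ErrorBound

/-! ### Union bound and oracle inequality. -/

theorem theorem2 {n N T K : ℕ} (hN : 1 ≤ N) (hT : 1 ≤ T)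
    (D : Measure (EuclideanSpace ℝ (Fin n))) [IsProbabilityMeasure D]
    (fstar : EuclideanSpace ℝ (Fin n) → EuclideanSpace ℝ (Fin n)) (hfstar : Measurable fstar)
    (ℓ : EuclideanSpace ℝ (Fin n) → ℝ) (hℓ_nonneg : ∀ x, 0 ≤ ℓ x)
    (hℓ_lip : LocallyLipschitz ℓ) (hℓ_zero : ℓ 0 = 0)
    (B : ℝ) (hB : 0 < B)
    (hbound : ∀ᵐ ξ ∂D, ∀ t ≤ T, ‖trajectory fstar ξ t‖ ≤ B)
    (L : ℝ≥0) (hL : 0 < L) (hL_lip : LipschitzOnWith L ℓ (Metric.closedBall 0 (2 * B)))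
    (F : ℕ → Set (EuclideanSpace ℝ (Fin n) → EuclideanSpace ℝ (Fin n)))
    (hF_nested : ∀ k, 1 ≤ k → k < K → F k ⊆ F (k + 1))
    (hF_meas : ∀ k, 1 ≤ k → k ≤ K → ∀ f ∈ F k, Measurable f)
    (hF_class : ∀ k, 1 ≤ k → k ≤ K → IsMeasurableClass D (lossClass ℓ fstar B T (F k)))
    (δ : ℝ) (hδ_pos : 0 < δ) (hδ_lt : δ < 1) :
    (∀ k, 1 ≤ k → k ≤ K →
      HasProbAtLeast (Measure.pi fun _ : Fin N => D) (1 - δ)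
        {S0 | ∀ f ∈ F k,
          |trueError ℓ fstar T D (clip B f) - trainError ℓ T (dataset fstar S0) (clip B f)| ≤
            errorBound L B T (F k) (dataset fstar S0) δ}) ∧
    HasProbAtLeast (Measure.pi fun _ : Fin N => D) (1 - δ)
      {S0 | ∀ fSRM, IsSRMPredictor ℓ L B T K F (dataset fstar S0) fSRM →
        ∀ f ∈ unionClass K F,
          trueError ℓ fstar T D (clip B fSRM) ≤
            trueError ℓ fstar T D (clip B f) +
              2 * errorBound L B T (F (minIndex K F f)) (dataset fstar S0)
                (2 * δ / ((K : ℝ) + 1))} := by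
  have hmain : ∀ k, 1 ≤ k → k ≤ K → ∀ δ : ℝ, 0 < δ → δ ≤ 4 →
      (Measure.pi fun _ : Fin N => D).real {S0 | ¬ ∀ f ∈ F k,
        |trueError ℓ fstar T D (clip B f) - trainError ℓ T (dataset fstar S0) (clip B f)| ≤
          errorBound L B T (F k) (dataset fstar S0) δ} ≤ δ / 2 := fun k hk1 hkK δ hδ hδ4 =>
    measureReal_errorBound_lt_le hN hfstar hℓ_nonneg hℓ_lip.continuous hℓ_zero hB hbound hL hL_lip
      (hF_meas k hk1 hkK) (hF_class k hk1 hkK) hδ hδ4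
  constructor
  · intro k hk1 hkK
    exact hasProbAtLeast_of_compl_le
      ((hmain k hk1 hkK δ hδ_pos (by linarith)).trans (by linarith))
  · set δ' : ℝ := 2 * δ / ((K : ℝ) + 1) with hδ'
    have hK : (0 : ℝ) < (K : ℝ) + 1 := by positivity
    have hδ'_pos : 0 < δ' := by positivity
    have hδ'_le : δ' ≤ 4 := by
      rw [hδ', div_le_iff₀ hK]
      nlinarith [(Nat.cast_nonneg K : (0 : ℝ) ≤ K)]
    refine hasProbAtLeast_of_compl_le ((measureReal_mono (s₂ := ⋃ k ∈ Finset.Icc 1 K,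
      {S0 | ¬ ∀ f ∈ F k,
        |trueError ℓ fstar T D (clip B f) - trainError ℓ T (dataset fstar S0) (clip B f)| ≤
          errorBound L B T (F k) (dataset fstar S0) δ'}) ?_ (measure_ne_top _ _)).trans
      ((measureReal_biUnion_finset_le _ _).trans
        ((Finset.sum_le_card_nsmul _ _ (δ' / 2) fun k hk => ?_).trans ?_)))
    · intro S0 hS0
      by_contra hcon
      simp only [Set.mem_iUnion, Finset.mem_Icc, Set.mem_ofPred_eq, exists_prop, not_exists,
        not_and, not_not] at hcon
      refine hS0 ?_
      rintro fSRM ⟨k, hk1, hkK, hfk, hmin⟩ f ⟨k', hk'1, hk'K, hfk'⟩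
      have hidx : minIndex K F f ∈ {k | 1 ≤ k ∧ k ≤ K ∧ f ∈ F k} :=
        Nat.sInf_mem ⟨k', hk'1, hk'K, hfk'⟩
      obtain ⟨hm1, hmK, hfm⟩ := hidx
      have h1 := (abs_le.1 (hcon k ⟨hk1, hkK⟩ fSRM hfk)).2
      have h2 := (abs_le.1 (hcon _ ⟨hm1, hmK⟩ f hfm)).1
      have h3 := hmin _ hm1 hmK f hfm
      -- The penalty of the selected class `F k` cancels against the SRM objective. The penalty of
      -- `F (minIndex K F f)` enters twice, through minimality and through the deviation of `f`.
      simp only [errorBound] at h1 h2 ⊢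
      linarith
    · rw [Finset.mem_Icc] at hk
      exact hmain k hk.1 hk.2 δ' hδ'_pos hδ'_le
    -- Each class fails with probability at most `δ' / 2 = δ / (K + 1)`, so the total is at most `K
    -- δ / (K + 1) ≤ δ`.
    · rw [Nat.card_Icc, Nat.add_sub_cancel, nsmul_eq_mul, hδ', div_div, mul_div_assoc',
        div_le_iff₀ (by positivity)]
      linarith
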